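/- Let $\mathsf{Topoi}$ be the 2-category of Grothendieck topoi, geometric morphisms $f=(f^*\dashv f_*)$ with $f^*$ left exact (in the direction of $f_*$), and natural transformations between inverse images. A geometric morphism $i$ is an embedding if $i_*$ is fully faithful, and flat if $i_*$ preserves finite colimits; $\mathsf{Emb}_\flat$ is the class of flat embeddings. A geometric morphism $f$ is spartan if $f_*$ preserves (small) directed colimits. A topos is coherent if it is equivalent to the topos of sheaves on a small site whose category has finite limits and in which every covering sieve contains a finite covering family. A topos $\mathcal{E}$ is right Kan injective with respect to $i:\mathcal{F}\to\mathcal{G}$ if $(-)\circ i:\mathsf{Topoi}(\mathcal{G},\mathcal{E})\to\mathsf{Topoi}(\mathcal{F},\mathcal{E})$ has a right adjoint $i_\sharp$ with invertible counit $i_\sharp(x)\circ i\Rightarrow x$; it is $\flat$-complete if this holds for all $i\in\mathsf{Emb}_\flat$. A geometric morphism $f:\mathcal{E}\to\mathcal{D}$ between $\flat$-complete topoi is right Kan injective with respect to $\mathsf{Emb}_\flat$ if for all $i:\mathcal{F}\to\mathcal{G}$ in $\mathsf{Emb}_\flat$ and $x:\mathcal{F}\to\mathcal{E}$, composition with $f$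 carries the right Kan extension of $x$ along $i$ in $\mathsf{Topoi}$ (the 1-cell $i_\sharp(x)$ with its counit) to a right Kan extension of $f\circ x$ along $i$. Let $\mathsf{RInj}(\mathsf{Emb}_\flat)$ be the locally full sub-2-category of $\mathsf{Topoi}$ on the $\flat$-complete topoi and the right Kan injective morphisms, and $\mathsf{CohTopoi}_{\mathcal{S}}$ the locally full sub-2-category on the coherent topoi and the spartan geometric morphisms between them. Then every spartan geometric morphism between $\flat$-complete topoi is right Kan injective with respect to $\mathsf{Emb}_\flat$. Moreover $\mathsf{CohTopoi}_{\mathcal{S}}$ is contained in $\mathsf{RInj}(\mathsf{Emb}_\flat)$: every coherent topos is $\flat$-complete, and every spartan geometric morphism between coherent topoi is right Kan injective with respect to $\mathsf{Emb}_\flat$. -/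

import Mathlib

open CategoryTheory CategoryTheory.Limits CategoryTheory.Bicategory

universe w v u

/-! ### Kan injectivity in a bicategory -/

section KanInjectivity

variable {B : Type u} [Bicategory.{w, v} B]

/-- A right extension `t` of `x` along `i` is a right Kan extension of `x` along `i` (in the
bicategory `B`): every right extension of `x` along `i` factors uniquely through it. -/
def IsRightKanExtension {a b c : B} {i : a ⟶ b} {x : a ⟶ c} (t : RightExtension i x) : Prop :=
  Nonempty t.IsUniversal

/-- The right extension of `x ≫ g` along `i` obtained by composing a right extension of `x`
along `i` with `g`. -/
def rightExtensionComp {a b c d : B} {i : a ⟶ b} {x : a ⟶ c} (t : RightExtension i x)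
    (g : c ⟶ d) : RightExtension i (x ≫ g) :=
  RightExtension.mk (t.extension ≫ g) ((α_ i t.extension g).inv ≫ t.counit ▷ g)

/-- An object `e` is right Kan injective with respect to `i : a ⟶ b` if the functor
`i ≫ - : (b ⟶ e) ⥤ (a ⟶ e)` has a right adjoint `R` for which the canonical
2-cells `i ≫ R x ⟶ x` (the counit of the adjunction) are invertible. -/
def IsRightKanInjective (e : B) {a b : B} (i : a ⟶ b) : Prop :=
  ∃ (R : (a ⟶ e) ⥤ (b ⟶ e)) (adj : precomp e i ⊣ R), IsIso adj.counit

/-- A 1-cell `g : e ⟶ d` preserves the right Kan extensions along `i : a ⟶ b`: whenever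
`t` is a right Kan extension of some `x : a ⟶ e` along `i`, the composite of `t` and `g` is a right
Kan extension of `x ≫ g` along `i`. -/
def PreservesRightKanExtensions {e d : B} (g : e ⟶ d) {a b : B} (i : a ⟶ b) : Prop :=
  ∀ (x : a ⟶ e) (t : RightExtension i x), IsRightKanExtension t →
    IsRightKanExtension (rightExtensionComp t g)

/-- An object is complete for a class `W` of 1-cells if it is right Kan injective with respect to
all members of `W`. -/
def IsRightKanComplete (W : ∀ {a b : B}, (a ⟶ b) → Prop) (e : B) : Prop :=
  ∀ ⦃a b : B⦄ (i : a ⟶ b), W i → IsRightKanInjective e i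

/-- A 1-cell `g : e ⟶ d` is right Kan injective with respect to a class `W` of 1-cells if `e` and
`d` are right Kan injective with respect to all members of `W` and `g` preserves the
right Kan extensions along all members of `W`. -/
structure IsRightKanInjectiveHom (W : ∀ {a b : B}, (a ⟶ b) → Prop) {e d : B} (g : e ⟶ d) :
    Prop where
  source : IsRightKanComplete W e
  target : IsRightKanComplete W d
  preserves : ∀ ⦃a b : B⦄ (i : a ⟶ b), W i → PreservesRightKanExtensions g i

lemma isRightKanExtension_iff {a b c : B} {i : a ⟶ b} {x : a ⟶ c} (t : RightExtension i x) :
    IsRightKanExtension t ↔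
      ∀ (k : b ⟶ c) (β : i ≫ k ⟶ x), ∃! σ : k ⟶ t.extension, i ◁ σ ≫ t.counit = β := by
  constructor
  · rintro ⟨h⟩ k β
    refine ⟨h.lift (RightExtension.mk k β), h.fac (RightExtension.mk k β), fun σ hσ => ?_⟩
    exact h.hom_ext (hσ.trans (h.fac (RightExtension.mk k β)).symm)
  · intro h
    choose σ hσ huniq using h
    refine ⟨IsTerminal.ofUniqueHom
      (fun s : RightExtension i x => RightExtension.homMk (σ s.left s.hom) (hσ _ _)) ?_⟩
    intro s m
    apply CostructuredArrow.hom_ext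
    exact huniq _ _ _ (RightExtension.w m)

/-- Right Kan extensions are invariant under isomorphism of the extended 1-cell and of the
extension. -/
lemma IsRightKanExtension.of_iso {a b c : B} {i : a ⟶ b} {x y : a ⟶ c}
    {t : RightExtension i x} {s : RightExtension i y} (ht : IsRightKanExtension t)
    (e : t.extension ≅ s.extension) (f : x ≅ y)
    (h : i ◁ e.hom ≫ s.counit = t.counit ≫ f.hom) : IsRightKanExtension s := by
  rw [isRightKanExtension_iff] at ht ⊢
  have h' : s.counit = i ◁ e.inv ≫ t.counit ≫ f.hom := by
    rw [← h, ← Category.assoc, ← Bicategory.whiskerLeft_comp]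
    simp
  intro k β
  obtain ⟨σ, hσ, huniq⟩ := ht k (β ≫ f.inv)
  refine ⟨σ ≫ e.hom, ?_, ?_⟩
  · simp only [Bicategory.whiskerLeft_comp, Category.assoc, h]
    rw [← Category.assoc, hσ]
    simp
  · intro τ hτ
    rw [← huniq (τ ≫ e.inv) ?_]
    · simp
    · simp only [h'] at hτ
      simp only [Bicategory.whiskerLeft_comp, Category.assoc]
      rw [← hτ]
      simp

lemma preservesRightKanExtensions_id (e : B) {a b : B} (i : a ⟶ b) :
    PreservesRightKanExtensions (𝟙 e) i := by
  intro x t ht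
  refine ht.of_iso (ρ_ _).symm (ρ_ _).symm ?_
  have key : ∀ (h : b ⟶ e) (β : i ≫ h ⟶ x),
      i ◁ (ρ_ h).inv ≫ (α_ i h (𝟙 e)).inv ≫ β ▷ 𝟙 e = β ≫ (ρ_ x).inv := by
    intro h β
    simp
  exact key _ _

lemma PreservesRightKanExtensions.comp {c d e : B} {f : c ⟶ d} {g : d ⟶ e} {a b : B} {i : a ⟶ b}
    (hf : PreservesRightKanExtensions f i) (hg : PreservesRightKanExtensions g i) :
    PreservesRightKanExtensions (f ≫ g) i := by
  intro x t ht
  refine (hg _ _ (hf _ _ ht)).of_iso (α_ _ _ _) (α_ _ _ _) ?_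
  have key : ∀ (h : b ⟶ c) (β : i ≫ h ⟶ x),
      i ◁ (α_ h f g).hom ≫ (α_ i h (f ≫ g)).inv ≫ β ▷ (f ≫ g) =
        ((α_ i (h ≫ f) g).inv ≫ ((α_ i h f).inv ≫ β ▷ f) ▷ g) ≫ (α_ x f g).hom := by
    intro h β
    simp
  exact key _ _

variable (B) in
/-- A locally full sub-2-category of `B`: a class of objects and a class of 1-cells between these
objects, closed under identities and composition. All the 2-cells are kept. -/
structure LocallyFullSub where
  obj : B → Prop
  hom : ∀ {a b : B}, (a ⟶ b) → Prop
  source : ∀ {a b : B} (f : a ⟶ b), hom f → obj a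
  target : ∀ {a b : B} (f : a ⟶ b), hom f → obj b
  id_mem : ∀ a : B, obj a → hom (𝟙 a)
  comp_mem : ∀ {a b c : B} (f : a ⟶ b) (g : b ⟶ c), hom f → hom g → hom (f ≫ g)

/-- `S.IsIncludedIn T`: every object and every 1-cell of `S` belongs to `T`, so that the identity
on objects, 1-cells and 2-cells is an inclusion 2-functor from `S` to `T`. -/
structure LocallyFullSub.IsIncludedIn (S T : LocallyFullSub B) : Prop where
  obj : ∀ a : B, S.obj a → T.obj a
  hom : ∀ {a b : B} (f : a ⟶ b), S.hom f → T.hom f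

/-- The locally full sub-2-category `RInj(W)` of objects and 1-cells that are right Kan
injective with respect to a class `W` of 1-cells. -/
def RInj (W : ∀ {a b : B}, (a ⟶ b) → Prop) : LocallyFullSub B where
  obj e := IsRightKanComplete W e
  hom g := IsRightKanInjectiveHom W g
  source _ h := h.source
  target _ h := h.target
  id_mem a h := ⟨h, h, fun _ _ i _ => preservesRightKanExtensions_id a i⟩
  comp_mem _ _ hf hg :=
    ⟨hf.source, hg.target, fun _ _ i hi => (hf.preserves i hi).comp (hg.preserves i hi)⟩

end KanInjectivity

/-! ### The 2-category of Grothendieck topoi -/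

/-- A Grothendieck topos: a category equivalent to the category of sheaves of sets on a small
site. -/
def IsGrothendieckTopos (E : Type (u + 1)) [Category.{u} E] : Prop :=
  ∃ (C : Type u) (_ : SmallCategory C) (J : GrothendieckTopology C),
    Nonempty (E ≌ Sheaf J (Type u))

/-- Bundled Grothendieck topoi. -/
structure Topoi : Type (u + 2) where
  carrier : Type (u + 1)
  [category : Category.{u} carrier]
  isTopos : IsGrothendieckTopos carrier

namespace Topoi

instance : CoeSort Topoi.{u} (Type (u + 1)) := ⟨Topoi.carrier⟩

instance (E : Topoi.{u}) : Category.{u} E := E.category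

/-- A geometric morphism `E ⟶ D`: a direct image functor `E ⥤ D` with a left adjoint inverse image
functor `D ⥤ E` that preserves finite limits. -/
structure GeomMorphism (E D : Topoi.{u}) where
  direct : E ⥤ D
  inverse : D ⥤ E
  adj : inverse ⊣ direct
  lex : PreservesFiniteLimits inverse

namespace GeomMorphism

/-- A 2-cell between geometric morphisms is a natural transformation between the inverse image
functors. -/
@[ext]
structure Hom {E D : Topoi.{u}} (f g : GeomMorphism E D) where
  app : f.inverse ⟶ g.inverse

instance {E D : Topoi.{u}} : Category (GeomMorphism E D) where
  Hom f g := Hom f g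
  id f := ⟨𝟙 f.inverse⟩
  comp η θ := ⟨η.app ≫ θ.app⟩

@[ext]
lemma hom_ext {E D : Topoi.{u}} {f g : GeomMorphism E D} {η θ : f ⟶ g} (h : η.app = θ.app) :
    η = θ :=
  Hom.ext h

/-- A natural isomorphism between inverse image functors is an invertible 2-cell. -/
@[simps]
def isoMk {E D : Topoi.{u}} {f g : GeomMorphism E D} (e : f.inverse ≅ g.inverse) : f ≅ g where
  hom := ⟨e.hom⟩
  inv := ⟨e.inv⟩
  hom_inv_id := hom_ext e.hom_inv_id
  inv_hom_id := hom_ext e.inv_hom_id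

/-- The identity geometric morphism. -/
@[simps]
def id (E : Topoi.{u}) : GeomMorphism E E where
  direct := 𝟭 E
  inverse := 𝟭 E
  adj := Adjunction.id
  lex := inferInstance

/-- The composite of geometric morphisms `F ⟶ E ⟶ D`. -/
@[simps]
def comp {F E D : Topoi.{u}} (f : GeomMorphism F E) (g : GeomMorphism E D) :
    GeomMorphism F D where
  direct := f.direct ⋙ g.direct
  inverse := g.inverse ⋙ f.inverse
  adj := g.adj.comp f.adj
  lex := by
    have := f.lex
    have := g.lex
    infer_instance

end GeomMorphism

instance : CategoryStruct Topoi.{u} where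
  Hom E D := GeomMorphism E D
  id E := GeomMorphism.id E
  comp f g := GeomMorphism.comp f g

instance : Bicategory Topoi.{u} where
  homCategory E D := inferInstanceAs (Category (GeomMorphism E D))
  whiskerLeft f _ _ η := ⟨Functor.whiskerRight η.app f.inverse⟩
  whiskerRight η h := ⟨Functor.whiskerLeft h.inverse η.app⟩
  associator f g h :=
    GeomMorphism.isoMk (Functor.associator h.inverse g.inverse f.inverse).symm
  leftUnitor f := GeomMorphism.isoMk (Functor.rightUnitor f.inverse)
  rightUnitor f := GeomMorphism.isoMk (Functor.leftUnitor f.inverse)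
  whiskerLeft_id := by
    intros _ _ _ f g
    refine GeomMorphism.Hom.ext (NatTrans.ext (funext fun X => ?_))
    exact f.inverse.map_id _
  whiskerLeft_comp := by
    intros _ _ _ f g h i η θ
    refine GeomMorphism.Hom.ext (NatTrans.ext (funext fun X => ?_))
    exact f.inverse.map_comp _ _
  id_whiskerLeft := by
    intros _ _ f g η
    refine GeomMorphism.Hom.ext (NatTrans.ext (funext fun X => ?_))
    change η.app.app X = 𝟙 _ ≫ η.app.app X ≫ 𝟙 _
    simp
  comp_whiskerLeft := by
    intros _ _ _ _ f g h h2 η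
    refine GeomMorphism.Hom.ext (NatTrans.ext (funext fun X => ?_))
    change f.inverse.map (g.inverse.map (η.app.app X)) =
      𝟙 _ ≫ f.inverse.map (g.inverse.map (η.app.app X)) ≫ 𝟙 _
    simp
  id_whiskerRight := by
    intros _ _ _ f g
    refine GeomMorphism.Hom.ext (NatTrans.ext (funext fun X => ?_))
    exact rfl
  comp_whiskerRight := by
    intros _ _ _ f g h η θ i
    refine GeomMorphism.Hom.ext (NatTrans.ext (funext fun X => ?_))
    exact rfl
  whiskerRight_id := by
    intros _ _ f g η
    refine GeomMorphism.Hom.ext (NatTrans.ext (funext fun X => ?_))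
    change η.app.app X = 𝟙 _ ≫ η.app.app X ≫ 𝟙 _
    simp
  whiskerRight_comp := by
    intros _ _ _ _ f f2 η g h
    refine GeomMorphism.Hom.ext (NatTrans.ext (funext fun X => ?_))
    change η.app.app (g.inverse.obj (h.inverse.obj X)) =
      𝟙 _ ≫ η.app.app (g.inverse.obj (h.inverse.obj X)) ≫ 𝟙 _
    simp
  whisker_assoc := by
    intros _ _ _ _ f g g2 η h
    refine GeomMorphism.Hom.ext (NatTrans.ext (funext fun X => ?_))
    change f.inverse.map (η.app.app (h.inverse.obj X)) =
      𝟙 _ ≫ f.inverse.map (η.app.app (h.inverse.obj X)) ≫ 𝟙 _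
    simp
  whisker_exchange := by
    intros _ _ _ f g h i η θ
    refine GeomMorphism.Hom.ext (NatTrans.ext (funext fun X => ?_))
    exact η.app.naturality (θ.app.app X)
  pentagon := by
    intros _ _ _ _ _ f g h i
    refine GeomMorphism.Hom.ext (NatTrans.ext (funext fun X => ?_))
    change 𝟙 _ ≫ 𝟙 _ ≫ f.inverse.map (𝟙 _) = 𝟙 _ ≫ 𝟙 _
    simp
  triangle := by
    intros _ _ _ f g
    refine GeomMorphism.Hom.ext (NatTrans.ext (funext fun X => ?_))
    change 𝟙 _ ≫ f.inverse.map (𝟙 _) = 𝟙 _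
    simp

/-- A geometric embedding: the direct image functor is fully faithful. -/
def IsEmbedding {F G : Topoi.{u}} (i : F ⟶ G) : Prop :=
  i.direct.Full ∧ i.direct.Faithful

/-- A flat geometric morphism: the direct image functor preserves finite colimits. -/
def IsFlat {F G : Topoi.{u}} (i : F ⟶ G) : Prop :=
  PreservesFiniteColimits i.direct

/-- The class of flat geometric embeddings. -/
def EmbFlat {F G : Topoi.{u}} (i : F ⟶ G) : Prop :=
  IsEmbedding i ∧ IsFlat i

/-- A topos is `♭`-complete if it is right Kan injective with respect to flat embeddings. -/
def IsFlatComplete (E : Topoi.{u}) : Prop :=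
  IsRightKanComplete EmbFlat E

/-- A spartan geometric morphism: the direct image functor preserves (small) directed colimits. -/
def IsSpartan {E D : Topoi.{u}} (f : E ⟶ D) : Prop :=
  ∀ (J : Type u) [PartialOrder J] [IsDirectedOrder J] [Nonempty J],
    PreservesColimitsOfShape J f.direct

/-- A coherent topos: a topos equivalent to the topos of sheaves on a small site with
finite limits in which every covering sieve contains a finite covering family. -/
def IsCoherent (E : Topoi.{u}) : Prop :=
  ∃ (C : Type u) (_ : SmallCategory C) (J : GrothendieckTopology C),
    HasFiniteLimits C ∧
    (∀ (X : C) (S : Sieve X), S ∈ J X → ∃ (n : ℕ) (Y : Fin n → C) (f : ∀ k, Y k ⟶ X),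
      (∀ k, S (f k)) ∧ Sieve.generate (Presieve.ofArrows Y f) ∈ J X) ∧
    Nonempty (E ≌ Sheaf J (Type u))

/-- The locally full sub-2-category of coherent topoi and spartan geometric morphisms. -/
def CohTopoiS : LocallyFullSub Topoi.{u} where
  obj E := IsCoherent E
  hom {E D} f := IsCoherent E ∧ IsCoherent D ∧ IsSpartan f
  source _ h := h.1
  target _ h := h.2.1
  id_mem E h := ⟨h, h, fun J _ _ _ => inferInstanceAs (PreservesColimitsOfShape J (𝟭 E))⟩
  comp_mem f g hf hg := ⟨hf.1, hg.2.1, fun J _ _ _ => by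
    have := hf.2.2 J
    have := hg.2.2 J
    exact inferInstanceAs (PreservesColimitsOfShape J (f.direct ⋙ g.direct))⟩

end Topoi

/-! Let `i : F ⟶ G` be a flat embedding and `x : F ⟶ E`. Transposing along `i^* ⊣ i_*`, right
extensions of `x` along `i` are transformations from an inverse image to `H = x^* ⋙ i_*`. This `H`
preserves finite limits and finite colimits, but need not be an inverse image. Suppose that `E` has
a site with finite limits whose coverings are respected by every functor to a topos with these
exactness properties (`IsFlatlyPresented`). Then Diaconescu's construction turns `H` restricted to
the site into a geometric morphism `T`, with a comparison `θ : T^* ⟶ H` invertible on the site.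
Coherent topoi are of this kind: a finite covering gives an epimorphism from a finite coproduct, and
`H` preserves both.

The universal property comes from `existsUnique_comp_eq`. Both `T^*` and `H` preserve finite
colimits, so `θ` is invertible on the closure of the site under finite colimits; every object of `E`
is a filtered colimit of objects of this closure. Hence a transformation `A ⟶ H` factors uniquely
through `θ` as soon as `A` preserves directed colimits. With `A = k^*` this makes `T` a right Kan
extension. With `A = f_* ⋙ k^*`, after transposing along `f^* ⊣ f_*`, it shows that every spartan
`f` preserves it.

An arbitrary flat-complete `E` is reduced to this case by a retraction. By
`exists_embFlat_isFlatlyPresented` there is a flat embedding `j` of `E` in a flatly presented `E'`,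
namely sheaves on a small dense subcategory of `E` for the topology of all sieves respected by the
functors above. Completeness extends the identity along `j` to a retraction `r`. Its universal
property gives `r^* ⊣ j^*`, so `r_* ≅ j^*` and `r` is spartan (`isSpartan_of_isRightKanExtension`).
If `f` is spartan, the extension of `x ≫ j` to `E'` is therefore preserved by `r` and by `r ≫ f`:
its image under `r` is the extension of `x`, and `f` preserves that one. -/

section Dense

/-! ### Dense functors. -/

variable {C : Type*} [Category* C] {D : Type*} [Category* D] {E : Type*} [Category* E]

/-- A family of maps from the morphisms `F c ⟶ Y` to the morphisms `F c ⟶ Z` that is natural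
in `c` is the same as a cocone with point `Z` over the canonical diagram at `Y`. -/
@[simps pt]
def canonicalCocone (F : C ⥤ D) {Y Z : D} (φ : ∀ c, (F.obj c ⟶ Y) → (F.obj c ⟶ Z))
    (hφ : ∀ ⦃c c'⦄ (f : c ⟶ c') (a : F.obj c' ⟶ Y), φ c (F.map f ≫ a) = F.map f ≫ φ c' a) :
    Cocone (CostructuredArrow.proj F Y ⋙ F) where
  pt := Z
  ι :=
    { app := fun k => φ k.left k.hom
      naturality := fun k k' f => by
        have h := CostructuredArrow.w f
        change F.map f.left ≫ φ _ _ = φ _ _ ≫ 𝟙 _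
        rw [← hφ, h, Category.comp_id] }

/-- An elementwise form of density that avoids cocones over comma categories; the density arguments
below only manipulate natural families `φ`. -/
lemma isDense_iff_existsUnique (F : C ⥤ D) : F.IsDense ↔
    ∀ (Y Z : D) (φ : ∀ c, (F.obj c ⟶ Y) → (F.obj c ⟶ Z))
      (_ : ∀ ⦃c c'⦄ (f : c ⟶ c') (a : F.obj c' ⟶ Y), φ c (F.map f ≫ a) = F.map f ≫ φ c' a),
      ∃! m : Y ⟶ Z, ∀ c (a : F.obj c ⟶ Y), a ≫ m = φ c a := by
  have hid {Y : D} (j : CostructuredArrow F Y) : ((Functor.LeftExtension.mk (𝟭 D)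
      F.rightUnitor.inv).coconeAt Y).ι.app j = j.hom := Category.id_comp _
  constructor
  · intro _ Y Z φ hφ
    refine ⟨(F.denseAt Y).desc (canonicalCocone F φ hφ), fun c a => ?_, fun m hm => ?_⟩
    · have h := (F.denseAt Y).fac (canonicalCocone F φ hφ) (CostructuredArrow.mk a)
      rw [hid] at h
      exact h
    · refine (F.denseAt Y).uniq (canonicalCocone F φ hφ) m fun j => ?_
      rw [hid]
      exact hm j.left j.hom
  · intro h
    refine ⟨fun Y => ⟨?_⟩⟩
    have hs (s : Cocone (CostructuredArrow.proj F Y ⋙ F)) ⦃c c'⦄ (f : c ⟶ c') (a : F.obj c' ⟶ Y) :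
        s.ι.app (CostructuredArrow.mk (F.map f ≫ a)) =
          F.map f ≫ s.ι.app (CostructuredArrow.mk a) :=
      (s.w (CostructuredArrow.homMk f rfl : CostructuredArrow.mk (F.map f ≫ a) ⟶
        CostructuredArrow.mk a)).symm
    choose m hm huniq using fun s : Cocone (CostructuredArrow.proj F Y ⋙ F) =>
      h Y s.pt (fun c a => s.ι.app (CostructuredArrow.mk a)) (hs s)
    refine { desc := m, fac := fun s j => ?_, uniq := fun s m' hm' => ?_ }
    · rw [hid]
      exact hm s j.left j.hom
    · refine huniq s m' fun c a => ?_
      have := hm' (CostructuredArrow.mk a)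
      rw [hid] at this
      exact this

lemma Functor.IsDense.hom_ext (F : C ⥤ D) [F.IsDense] {Y Z : D} {m m' : Y ⟶ Z}
    (h : ∀ c (a : F.obj c ⟶ Y), a ≫ m = a ≫ m') : m = m' :=
  ((isDense_iff_existsUnique F).1 inferInstance Y Z (fun _ a => a ≫ m) (by simp)).unique
    (fun _ _ => rfl) (fun c a => (h c a).symm)

/-- A natural family over `D` is determined by its restriction to `C`: a map out of `G.obj d` is
tested on maps from objects `G.obj (F.obj c)`, and fullness lifts these to `D`, where naturality
applies. -/
lemma isDense_of_isDense_comp (F : C ⥤ D) (G : D ⥤ E) [G.Full] [(F ⋙ G).IsDense] :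
    G.IsDense := by
  rw [isDense_iff_existsUnique]
  intro Y Z φ hφ
  obtain ⟨m, hm, huniq⟩ := (isDense_iff_existsUnique (F ⋙ G)).1 inferInstance Y Z
    (fun c a => φ (F.obj c) a) (fun c c' f a => hφ (F.map f) a)
  refine ⟨m, fun d a => ?_, fun m' hm' => huniq m' fun c a => hm' _ a⟩
  refine Functor.IsDense.hom_ext (F ⋙ G) fun c b => ?_
  have h1 := hφ (G.preimage b) a
  rw [G.map_preimage] at h1
  have h2 := hm c (b ≫ a)
  rw [Category.assoc] at h2
  exact h2.trans h1

lemma isDense_comp_of_reflective (F : C ⥤ D) [F.IsDense] {L : D ⥤ E} {R : E ⥤ D} (adj : L ⊣ R)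
    [R.Full] [R.Faithful] : (F ⋙ L).IsDense := by
  rw [isDense_iff_existsUnique]
  intro Y Z φ hφ
  obtain ⟨m, hm, huniq⟩ := (isDense_iff_existsUnique F).1 inferInstance (R.obj Y) (R.obj Z)
    (fun c a => adj.homEquiv _ _ (φ c ((adj.homEquiv _ _).symm a))) (fun c c' f a => by
      rw [Adjunction.homEquiv_naturality_left_symm, ← Adjunction.homEquiv_naturality_left]
      exact congrArg _ (hφ f _))
  refine ⟨R.preimage m, fun c a => ?_, fun m' hm' => ?_⟩
  · apply (adj.homEquiv _ _).injective
    have := hm c (adj.homEquiv _ _ a)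
    rw [Equiv.symm_apply_apply] at this
    rw [Adjunction.homEquiv_naturality_right, R.map_preimage]
    exact this
  · apply R.map_injective
    rw [R.map_preimage]
    refine huniq _ fun c a => ?_
    have := hm' c ((adj.homEquiv _ _).symm a)
    rw [← this, Adjunction.homEquiv_naturality_right, Equiv.apply_symm_apply]

end Dense

/-! ### Extending and lifting transformations from a dense subcategory. -/

section Extension

variable {C : Type*} [Category* C] {E : Type*} [Category* E] {G : Type*} [Category* G]

/-- A functor that preserves the canonical colimits over a dense functor `F` is a left Kan
extension of its restriction along `F`. -/
lemma existsUnique_whiskerLeft_eq (F : C ⥤ E) [F.IsDense] (A B : E ⥤ G)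
    [∀ Y, PreservesColimit (CostructuredArrow.proj F Y ⋙ F) A] (ψ : F ⋙ A ⟶ F ⋙ B) :
    ∃! σ : A ⟶ B, ∀ c, σ.app (F.obj c) = ψ.app c := by
  have hid {Y : E} (j : CostructuredArrow F Y) : ((Functor.LeftExtension.mk (𝟭 E)
      F.rightUnitor.inv).coconeAt Y).ι.app j = j.hom := Category.id_comp _
  let hc (Y : E) := isColimitOfPreserves A (F.denseAt Y)
  have hι (Y : E) (j : CostructuredArrow F Y) : (A.mapCocone ((Functor.LeftExtension.mk (𝟭 E)
      F.rightUnitor.inv).coconeAt Y)).ι.app j = A.map j.hom := congrArg A.map (hid j)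
  have ext {Y : E} {Z : G} {m m' : A.obj Y ⟶ Z}
      (h : ∀ c (a : F.obj c ⟶ Y), A.map a ≫ m = A.map a ≫ m') : m = m' := by
    refine (hc Y).hom_ext fun j => ?_
    rw [hι]
    exact h _ _
  let s (Y : E) : Cocone ((CostructuredArrow.proj F Y ⋙ F) ⋙ A) :=
    { pt := B.obj Y
      ι :=
        { app := fun j => ψ.app j.left ≫ B.map j.hom
          naturality := fun j j' f => by
            have h := ψ.naturality f.left
            have h2 : B.map j.hom = B.map (F.map f.left) ≫ B.map j'.hom := by
              rw [← B.map_comp, CostructuredArrow.w f]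
            refine Eq.trans ?_ (Category.comp_id _).symm
            rw [h2]
            exact (reassoc_of% h) _ } }
  have fac (Y : E) : ∃ d : A.obj Y ⟶ B.obj Y, ∀ (c : C) (a : F.obj c ⟶ Y),
      A.map a ≫ d = ψ.app c ≫ B.map a := ⟨(hc Y).desc (s Y), fun c a => by
    have := (hc Y).fac (s Y) (CostructuredArrow.mk a)
    rw [hι] at this
    exact this⟩
  choose d fac using fac
  refine ⟨{ app := d, naturality := fun Y Z f => ext fun c a => ?_ },
    fun c => ?_, fun σ hσ => ?_⟩
  · rw [← A.map_comp_assoc, fac, reassoc_of% (fac Y c a), B.map_comp]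
  · have := fac _ c (𝟙 _)
    simpa using this
  · ext Y
    refine ext fun c a => ?_
    rw [fac, σ.naturality, hσ]

end Extension

section Lift

variable {C : Type u} [SmallCategory C] {E : Type (u + 1)} [Category.{u} E]
  {G : Type (u + 1)} [Category.{u} G]

lemma preservesColimitsOfShape_of_finite_arrow {E G : Type*} [Category* E] [Category* G]
    (J : Type u) [SmallCategory J] [Finite (Arrow J)] (T : E ⥤ G) [PreservesFiniteColimits T] :
    PreservesColimitsOfShape J T := by
  have : Finite J := Finite.of_injective (fun j => Arrow.mk (𝟙 j)) fun j j' h =>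
    congrArg Comma.left h
  have (j j' : J) : Finite (j ⟶ j') := Finite.of_injective (fun f => Arrow.mk f) fun f g h => by
    exact eq_of_heq (congr_arg_heq Comma.hom h)
  have : FinCategory J := ⟨Fintype.ofFinite J, fun _ _ => Fintype.ofFinite _⟩
  infer_instance

/-- A functor preserves directed colimits. -/
def PreservesDirectedColimits (A : E ⥤ G) : Prop :=
  ∀ (J : Type u) [PartialOrder J] [IsDirectedOrder J] [Nonempty J], PreservesColimitsOfShape J A

/-- Every small filtered category receives a final functor from a directed poset. -/
lemma PreservesDirectedColimits.preservesColimitsOfShape {A : E ⥤ G}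
    (hA : PreservesDirectedColimits A) (J : Type*) [Category* J] [IsFiltered J]
    [EssentiallySmall.{u} J] : PreservesColimitsOfShape J A := by
  have : IsFiltered (SmallModel.{u} J) := IsFiltered.of_equivalence (equivSmallModel.{u} J)
  obtain ⟨α, _, _, _, Φ, _⟩ := IsFiltered.exists_directed (SmallModel.{u} J)
  have := hA α
  have := Functor.Final.preservesColimitsOfShape_of_final Φ A
  exact preservesColimitsOfShape_of_equiv (equivSmallModel.{u} J).symm A

attribute [local instance] Cardinal.fact_isRegular_aleph0 in
/-- If `θ : T ⟶ H` is a transformation between functors preserving finite colimits that is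
invertible on a dense small subcategory, then transformations to `H` from a functor preserving
directed colimits factor uniquely through `θ`. -/
lemma existsUnique_comp_eq [HasColimits E] (F : C ⥤ E) [F.IsDense] {T H : E ⥤ G}
    [PreservesFiniteColimits T] [PreservesFiniteColimits H] (θ : T ⟶ H)
    (hθ : ∀ c, IsIso (θ.app (F.obj c))) {A : E ⥤ G} (hA : PreservesDirectedColimits A)
    (β : A ⟶ H) : ∃! σ : A ⟶ T, σ ≫ θ = β := by
  let P : ObjectProperty E := ObjectProperty.ofObj F.obj
  let K := P.colimitsCardinalClosure Cardinal.aleph0.{u}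
  have hK : ObjectProperty.EssentiallySmall.{u} K := by dsimp [K]; infer_instance
  let F' : C ⥤ K.FullSubcategory := K.lift F fun c =>
    P.le_colimitsCardinalClosure _ _ (ObjectProperty.ofObj_apply F.obj c)
  have : (F' ⋙ K.ι).IsDense := inferInstanceAs F.IsDense
  have : K.ι.IsDense := isDense_of_isDense_comp F' K.ι
  have hiso (k : K.FullSubcategory) : IsIso (θ.app k.obj) := by
    -- The objects at which `θ` is invertible are closed under finite colimits, since `T` and `H`
    -- preserve them; hence they contain `K`.
    let Q : ObjectProperty E := fun X => IsIso (θ.app X)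
    have : Q.IsClosedUnderIsomorphisms := ⟨fun {X Y} e (h : IsIso _) => by
      have := θ.naturality e.hom
      change IsIso _
      have h2 : θ.app Y = T.map e.inv ≫ θ.app X ≫ H.map e.hom := by
        rw [← θ.naturality, ← T.map_comp_assoc]; simp
      rw [h2]
      infer_instance⟩
    have hQ : K ≤ Q := by
      refine P.colimitsCardinalClosure_le _ (fun J _ hJ => ?_) ?_
      · have : Finite (Arrow J) := by rwa [hasCardinalLT_aleph0_iff] at hJ
        have := preservesColimitsOfShape_of_finite_arrow J T
        have := preservesColimitsOfShape_of_finite_arrow J H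
        refine ⟨?_⟩
        rintro X ⟨p⟩
        have (j : J) : IsIso (θ.app (p.diag.obj j)) := p.prop_diag_obj j
        let e : p.diag ⋙ T ≅ p.diag ⋙ H := NatIso.ofComponents
          (fun j => asIso (θ.app (p.diag.obj j))) (fun f => θ.naturality _)
        have h : θ.app X = ((isColimitOfPreserves T p.isColimit).coconePointsIsoOfNatIso
            (isColimitOfPreserves H p.isColimit) e).hom := by
          refine (isColimitOfPreserves T p.isColimit).hom_ext fun j => ?_
          rw [IsColimit.comp_coconePointsIsoOfNatIso_hom]
          exact θ.naturality _
        change IsIso (θ.app X)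
        rw [h]
        infer_instance
      · rintro _ ⟨c⟩
        exact hθ c
    exact hQ _ k.property
  -- Closure of `K` under finite colimits makes the canonical diagrams filtered, which is what lets
  -- `A` preserve them.
  have hcol (Y : E) : PreservesColimit (CostructuredArrow.proj K.ι Y ⋙ K.ι) A := by
    have : EssentiallySmall.{u} (CostructuredArrow K.ι Y) := inferInstance
    have : IsFiltered (CostructuredArrow K.ι Y) := inferInstance
    have := hA.preservesColimitsOfShape (CostructuredArrow K.ι Y)
    infer_instance
  let ψ : K.ι ⋙ A ⟶ K.ι ⋙ T :=
    { app := fun k => β.app k.obj ≫ inv (θ.app k.obj)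
      naturality := fun k k' f => by
        rw [← cancel_mono (θ.app k'.obj)]
        simp }
  obtain ⟨σ, hσ, huniq⟩ := existsUnique_whiskerLeft_eq K.ι A T ψ
  refine ⟨σ, ?_, fun τ hτ => huniq τ fun k => ?_⟩
  -- `σ ≫ θ` and `β` agree on `K`, and transformations out of `A` are determined there.
  · obtain ⟨_, _, h⟩ := existsUnique_whiskerLeft_eq K.ι A H (Functor.whiskerLeft K.ι β)
    refine (h _ fun k => ?_).trans (h _ fun k => ?_).symm
    · have := hσ k
      dsimp at this ⊢
      simp [this, ψ]
    · simp
  · simp [ψ, ← hτ]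

end Lift

/-! ### Left exactness of Yoneda extensions. -/

section YonedaExtension

variable {C : Type u} [SmallCategory C]

/-- The Yoneda extension of a functor restricts to this functor. -/
noncomputable def uliftYonedaCompLeftKanExtensionIso {E : Type*} [Category.{u} E] [HasColimits E]
    (F : C ⥤ E) : uliftYoneda.{u} ⋙ uliftYoneda.{u}.leftKanExtension F ≅ F :=
  (asIso (uliftYoneda.{u}.leftKanExtensionUnit F)).symm

lemma preservesColimits_leftKanExtension {E : Type*} [Category.{u} E] [HasColimits E]
    (F : C ⥤ E) :
    PreservesColimitsOfSize.{u, u} ((uliftYoneda.{u} (C := C)).leftKanExtension F) :=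
  Presheaf.preservesColimitsOfSize_leftKanExtension.{u} F

/-- A left exact functor to sets has a cofiltered category of elements, so it is a point of the site
whose only covering sieves are the maximal ones. The fiber functor of this point is left exact and
is the Yoneda extension of `F`. -/
lemma preservesFiniteLimits_leftKanExtension_type [HasFiniteLimits C] (F : C ⥤ Type u)
    [PreservesFiniteLimits F] :
    PreservesFiniteLimits ((uliftYoneda.{u} (C := C)).leftKanExtension F) := by
  have : IsCofiltered F.Elements := Functor.isCofiltered_elements F
  let Φ : GrothendieckTopology.Point.{u} (⊥ : GrothendieckTopology C) :=
    { fiber := F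
      initiallySmall := initiallySmall_of_essentiallySmall _
      jointly_surjective := fun {X} R h x => by
        rw [GrothendieckTopology.bot_covering] at h
        subst h
        exact ⟨X, 𝟙 X, trivial, x, by simp⟩ }
  have e : uliftYoneda.{u} ⋙ (Φ.presheafFiber (A := Type u)) ≅ F :=
    Functor.isoWhiskerRight uliftYonedaIsoShrinkYoneda.{u} Φ.presheafFiber ≪≫
      Φ.shrinkYonedaCompPresheafFiberIso
  exact preservesFiniteLimits_of_natIso
    (Presheaf.uniqueExtensionAlongULiftYoneda.{u} _ e.symm)

lemma preservesFiniteLimits_leftKanExtension_presheaf [HasFiniteLimits C] {D : Type u}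
    [SmallCategory D] (F : C ⥤ Dᵒᵖ ⥤ Type u) [PreservesFiniteLimits F] :
    PreservesFiniteLimits ((uliftYoneda.{u} (C := C)).leftKanExtension F) := by
  apply preservesFiniteLimits_of_preservesFiniteLimitsOfSize.{u}
  intro J _ _
  refine preservesLimitsOfShape_of_evaluation _ J fun d => ?_
  let ev := (evaluation Dᵒᵖ (Type u)).obj d
  have := preservesFiniteLimits_leftKanExtension_type (F ⋙ ev)
  have e := uliftYonedaCompLeftKanExtensionIso F
  have := preservesColimits_leftKanExtension F
  have : PreservesColimitsOfSize.{u, u} (uliftYoneda.{u}.leftKanExtension F ⋙ ev) :=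
    comp_preservesColimits _ _
  exact preservesLimitsOfShape_of_natIso (Presheaf.uniqueExtensionAlongULiftYoneda.{u}
    (uliftYoneda.{u}.leftKanExtension F ⋙ ev)
      ((Functor.isoWhiskerRight e.symm ev ≪≫ Functor.associator _ _ _))).symm

/-- Extend `P` to presheaves on `D` first, then sheafify. The result is left exact, preserves
colimits and restricts to `P`, so it is the Yoneda extension of `P`. -/
lemma preservesFiniteLimits_leftKanExtension_topos [HasFiniteLimits C] {G : Type (u + 1)}
    [Category.{u} G] [HasColimits G] {D : Type u} [SmallCategory D] {K : GrothendieckTopology D}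
    (e : G ≌ Sheaf K (Type u)) (P : C ⥤ G) [PreservesFiniteLimits P] :
    PreservesFiniteLimits ((uliftYoneda.{u} (C := C)).leftKanExtension P) := by
  let Q := P ⋙ e.functor ⋙ sheafToPresheaf K (Type u)
  have : PreservesFiniteLimits (e.functor ⋙ sheafToPresheaf K (Type u)) :=
    comp_preservesFiniteLimits _ _
  have : PreservesFiniteLimits Q := comp_preservesFiniteLimits _ _
  have := preservesFiniteLimits_leftKanExtension_presheaf Q
  let L := (uliftYoneda.{u} (C := C)).leftKanExtension P
  let L₀ := (uliftYoneda.{u} (C := C)).leftKanExtension Q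
  let i₁ : uliftYoneda.{u} ⋙ L₀ ⋙ presheafToSheaf K (Type u) ⋙ e.inverse ≅ P :=
    (Functor.associator _ _ _).symm ≪≫ Functor.isoWhiskerRight
      (uliftYonedaCompLeftKanExtensionIso Q) (presheafToSheaf K (Type u) ⋙ e.inverse) ≪≫
      Functor.isoWhiskerLeft (P ⋙ e.functor) (Functor.isoWhiskerRight
        (asIso (sheafificationAdjunction K (Type u)).counit) e.inverse :
          (sheafToPresheaf K (Type u) ⋙ presheafToSheaf K (Type u)) ⋙ e.inverse ≅
          𝟭 _ ⋙ e.inverse) ≪≫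
      Functor.isoWhiskerLeft P e.unitIso.symm
  have : PreservesFiniteLimits (L₀ ⋙ presheafToSheaf K (Type u) ⋙ e.inverse) := by
    have : PreservesFiniteLimits (presheafToSheaf K (Type u) ⋙ e.inverse) :=
      comp_preservesFiniteLimits _ _
    exact comp_preservesFiniteLimits _ _
  have : PreservesColimitsOfSize.{u, u} (L₀ ⋙ presheafToSheaf K (Type u) ⋙ e.inverse) := by
    have : PreservesColimitsOfSize.{u, u} (presheafToSheaf K (Type u) ⋙ e.inverse) :=
      comp_preservesColimits _ _
    have := preservesColimits_leftKanExtension Q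
    exact comp_preservesColimits _ _
  exact preservesFiniteLimits_of_natIso (Presheaf.uniqueExtensionAlongULiftYoneda.{u}
    (L₀ ⋙ presheafToSheaf K (Type u) ⋙ e.inverse) i₁.symm)

end YonedaExtension

/-! ### Gluing morphisms of sheaves along jointly locally surjective families. -/

section SheafGlue

open Opposite

variable {D : Type u} [SmallCategory D] {K : GrothendieckTopology D}

/-- The sieve of morphisms along which a section `y` of the sheaf `X` lifts to one of the
sheaves `U i`. -/
def liftSieve {ι : Type*} {X : Sheaf K (Type u)} {U : ι → Sheaf K (Type u)} (p : ∀ i, U i ⟶ X)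
    {d : D} (y : X.obj.obj (op d)) : Sieve d where
  arrows d' t := ∃ (i : ι) (z : (U i).obj.obj (op d')), (p i).hom.app _ z = X.obj.map t.op y
  downward_closed := by
    rintro d' d'' t ⟨i, z, hz⟩ s
    refine ⟨i, (U i).obj.map s.op z, ?_⟩
    rw [NatTrans.naturality_apply, hz, op_comp, Functor.map_comp_apply]

/-- A family of morphisms of sheaves is jointly locally surjective. -/
def JointlyLocallySurjective {ι : Type*} {X : Sheaf K (Type u)} {U : ι → Sheaf K (Type u)}
    (p : ∀ i, U i ⟶ X) : Prop :=
  ∀ (d : D) (y : X.obj.obj (op d)), liftSieve p y ∈ K d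

lemma sheaf_separated (X : Sheaf K (Type u)) {d : D} {S : Sieve d} (hS : S ∈ K d)
    {y y' : X.obj.obj (op d)}
    (h : ∀ ⦃d'⦄ (t : d' ⟶ d), S t → X.obj.map t.op y = X.obj.map t.op y') : y = y' :=
  (((isSheaf_iff_isSheaf_of_type _ _).1 X.property).isSeparated S hS).ext fun _ t ht => h t ht

lemma JointlyLocallySurjective.existsUnique_desc {ι : Type*} {X : Sheaf K (Type u)}
    {U : ι → Sheaf K (Type u)} {p : ∀ i, U i ⟶ X} (hp : JointlyLocallySurjective p)
    {Y : Sheaf K (Type u)} (x : ∀ i, U i ⟶ Y)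
    (hx : ∀ (i j : ι) (d : D) (z : (U i).obj.obj (op d)) (w : (U j).obj.obj (op d)),
      (p i).hom.app _ z = (p j).hom.app _ w → (x i).hom.app _ z = (x j).hom.app _ w) :
    ∃! m : X ⟶ Y, ∀ i, p i ≫ m = x i := by
  have hY := (isSheaf_iff_isSheaf_of_type _ _).1 Y.property
  have key (d : D) (y : X.obj.obj (op d)) : ∃ v : Y.obj.obj (op d),
      ∀ (d' : D) (t : d' ⟶ d) (i : ι) (z : (U i).obj.obj (op d')),
        (p i).hom.app _ z = X.obj.map t.op y → (x i).hom.app _ z = Y.obj.map t.op v := by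
    -- The lift of `y` along `t` is chosen arbitrarily; `hx` makes its image in `Y` independent of
    -- the choice.
    let fam : Presieve.FamilyOfElements Y.obj (liftSieve p y).arrows := fun d' t ht =>
      (x ht.choose).hom.app _ ht.choose_spec.choose
    have hfam (d' : D) (t : d' ⟶ d) (ht : liftSieve p y t) (i : ι) (z : (U i).obj.obj (op d'))
        (hz : (p i).hom.app _ z = X.obj.map t.op y) : (x i).hom.app _ z = fam t ht :=
      hx _ _ _ _ _ (hz.trans ht.choose_spec.choose_spec.symm)
    have hc : fam.Compatible := by
      rw [Presieve.compatible_iff_sieveCompatible]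
      intro d' d'' t s ht
      have ht' := ht
      obtain ⟨i, z, hz⟩ := ht'
      rw [← hfam _ t ht i z hz, ← NatTrans.naturality_apply]
      symm
      refine hfam _ _ _ i _ ?_
      rw [NatTrans.naturality_apply, hz, op_comp, Functor.map_comp_apply]
    obtain ⟨v, hv, -⟩ := hY _ (hp d y) fam hc
    exact ⟨v, fun d' t i z hz => (hfam d' t ⟨i, z, hz⟩ i z hz).trans (hv t ⟨i, z, hz⟩).symm⟩
  choose m hm using key
  have hm1 (i : ι) (d : D) (z : (U i).obj.obj (op d)) :
      m d ((p i).hom.app _ z) = (x i).hom.app _ z := by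
    have := hm d ((p i).hom.app _ z) d (𝟙 d) i z (by simp)
    simpa using this.symm
  let μ : X ⟶ Y := ⟨{
    app := fun d => ↾(m d.unop)
    naturality := fun d d' s => by
      ext y
      refine sheaf_separated Y (hp _ (X.obj.map s y)) fun d'' t ht => ?_
      obtain ⟨i, z, hz⟩ := ht
      have h1 := hm _ _ _ t i z hz
      have h2 := hm _ y _ (t ≫ s.unop) i z (by rw [hz]; simp)
      change Y.obj.map t.op (m _ (X.obj.map s y)) = Y.obj.map t.op (Y.obj.map s (m _ y))
      rw [← h1, h2]
      simp }⟩
  refine ⟨μ, fun i => ?_, fun μ' hμ' => ?_⟩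
  · ext d z
    exact hm1 i _ z
  · ext d y
    refine sheaf_separated Y (hp _ y) fun d' t ht => ?_
    obtain ⟨i, z, hz⟩ := ht
    change Y.obj.map t.op (μ'.hom.app d y) = Y.obj.map t.op (m _ y)
    rw [← hm _ _ _ t i z hz, ← hμ' i, ← NatTrans.naturality_apply, ← hz]
    rfl

/-- The image under a functor to sheaves of the morphisms of a sieve is jointly locally
surjective. -/
def IsLocallySurjectiveOn {C : Type*} [Category* C] (P : C ⥤ Sheaf K (Type u)) {c : C}
    (S : Sieve c) : Prop :=
  JointlyLocallySurjective (ι := Σ c' : C, {f : c' ⟶ c // S f}) fun i => P.map i.2.1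

lemma isLocallySurjectiveOn_of_iso {C : Type*} [Category* C] {P Q : C ⥤ Sheaf K (Type u)}
    (e : P ≅ Q) {c : C} {S : Sieve c} (h : IsLocallySurjectiveOn P S) :
    IsLocallySurjectiveOn Q S := by
  intro d y
  refine K.superset_covering ?_ (h d ((e.inv.app c).hom.app _ y))
  rintro d' t ⟨i, z, hz⟩
  refine ⟨i, (e.hom.app _).hom.app _ z, ?_⟩
  have h1 := congr($(e.hom.naturality i.2.1).hom.app (op d') z)
  have h2 := congr($(e.inv_hom_id_app c).hom.app (op d) y)
  refine h1.symm.trans ?_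
  change (e.hom.app c).hom.app (op d') ((P.map i.2.1).hom.app (op d') z) = _
  rw [hz, NatTrans.naturality_apply]
  exact congrArg _ h2

lemma exists_pullback_section {X Y Z : Sheaf K (Type u)} {W : Sheaf K (Type u)} {a : W ⟶ X}
    {b : W ⟶ Y} {f : X ⟶ Z} {g : Y ⟶ Z} (h : IsPullback a b f g) {d : D}
    (x : X.obj.obj (op d)) (y : Y.obj.obj (op d)) (hxy : f.hom.app _ x = g.hom.app _ y) :
    ∃ w : W.obj.obj (op d), a.hom.app _ w = x ∧ b.hom.app _ w = y := by
  have h1 := (h.map (sheafToPresheaf K (Type u))).map ((evaluation _ _).obj (op d))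
  rw [Types.isPullback_iff] at h1
  exact h1.2.2 x y hxy

/-- Two sections with the same image come from a section over the pullback, which `P` preserves;
compatibility on pullbacks in `C` thus suffices to glue. -/
lemma isSheafFor_hom_of_isLocallySurjectiveOn {C : Type*} [Category.{u} C] [HasPullbacks C]
    (P : C ⥤ Sheaf K (Type u)) [PreservesFiniteLimits P] {c : C} {S : Sieve c}
    (hS : IsLocallySurjectiveOn P S) (Y : Sheaf K (Type u)) :
    Presieve.IsSheafFor (P.op ⋙ yoneda.obj Y) S.arrows := by
  intro x hx
  obtain ⟨m, hm, huniq⟩ := hS.existsUnique_desc (Y := Y) (fun i => x i.2.1 i.2.2) (by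
    rintro ⟨c₁, f, hf⟩ ⟨c₂, g, hg⟩ d z w h
    obtain ⟨v, rfl, rfl⟩ := exists_pullback_section
      ((IsPullback.of_hasPullback f g).map P) z w h
    have := hx (pullback.fst f g) (pullback.snd f g) hf hg pullback.condition
    exact congr($(this).hom.app (op d) v))
  exact ⟨m, fun c' f hf => hm ⟨c', f, hf⟩, fun m' hm' => huniq _ fun i => hm' i.2.1 i.2.2⟩

end SheafGlue

/-! ### Geometric morphisms from left exact functors that respect coverings. -/

section Diaconescu

variable {C : Type u} [SmallCategory C] (J : GrothendieckTopology C)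

/-- The canonical functor from a site to the category of sheaves. -/
noncomputable def toSheaves : C ⥤ Sheaf J (Type u) :=
  uliftYoneda.{u} ⋙ presheafToSheaf J (Type u)

instance : (toSheaves J).IsDense :=
  isDense_comp_of_reflective _ (sheafificationAdjunction J (Type u))

instance [HasFiniteLimits C] : PreservesFiniteLimits (toSheaves J) := by
  have : PreservesFiniteLimits (uliftYoneda.{u} (C := C)) :=
    preservesFiniteLimits_of_natIso
      ((shrinkYonedaIsoYoneda (C := C)).symm ≪≫ uliftYonedaIsoShrinkYoneda.{u}.symm)
  exact comp_preservesFiniteLimits _ _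

variable {J} {D : Type u} [SmallCategory D] {K : GrothendieckTopology D}
  {G : Type (u + 1)} [Category.{u} G] (e : G ≌ Sheaf K (Type u)) (P : C ⥤ G)

lemma isSheaf_restrictedULiftYoneda [HasFiniteLimits C] [PreservesFiniteLimits P]
    (hP : ∀ ⦃c : C⦄ (S : Sieve c), S ∈ J c → IsLocallySurjectiveOn (P ⋙ e.functor) S) (Y : G) :
    Presheaf.IsSheaf J ((Presheaf.restrictedULiftYoneda.{u} P).obj Y) := by
  rw [isSheaf_iff_isSheaf_of_type]
  intro c S hS
  have : PreservesFiniteLimits (P ⋙ e.functor) := comp_preservesFiniteLimits _ _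
  refine Presieve.isSheafFor_iso ?_ (isSheafFor_hom_of_isLocallySurjectiveOn _ (hP S hS)
    (e.functor.obj Y))
  exact NatIso.ofComponents (fun c => (Equiv.trans (e.fullyFaithfulFunctor.homEquiv).symm
    Equiv.ulift.symm).toIso) (fun f => by
      ext g
      apply ULift.down_injective
      apply e.functor.map_injective
      refine (e.fullyFaithfulFunctor.map_preimage _).trans ?_
      change _ = e.functor.map (P.map f.unop ≫ e.fullyFaithfulFunctor.preimage g)
      rw [e.functor.map_comp, e.fullyFaithfulFunctor.map_preimage]
      rfl)

variable (J) in
/-- The direct image functor attached to a left exact functor that maps coverings to jointly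
locally surjective families. -/
noncomputable def flatDirectImage [HasFiniteLimits C] [PreservesFiniteLimits P]
    (hP : ∀ ⦃c : C⦄ (S : Sieve c), S ∈ J c → IsLocallySurjectiveOn (P ⋙ e.functor) S) :
    G ⥤ Sheaf J (Type u) :=
  ObjectProperty.lift _ (Presheaf.restrictedULiftYoneda.{u} P)
    (isSheaf_restrictedULiftYoneda e P hP)

variable (J) in
/-- The inverse image functor attached to a left exact functor. -/
noncomputable def flatInverseImage [HasColimits G] : Sheaf J (Type u) ⥤ G :=
  sheafToPresheaf J (Type u) ⋙ uliftYoneda.{u}.leftKanExtension P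

/-- The inverse image functor is left adjoint to the direct image functor. -/
noncomputable def flatAdjunction [HasColimits G] [HasFiniteLimits C] [PreservesFiniteLimits P]
    (hP : ∀ ⦃c : C⦄ (S : Sieve c), S ∈ J c → IsLocallySurjectiveOn (P ⋙ e.functor) S) :
    flatInverseImage J P ⊣ flatDirectImage J e P hP :=
  (Presheaf.uliftYonedaAdjunction.{u} (uliftYoneda.{u}.leftKanExtension P)
    (uliftYoneda.{u}.leftKanExtensionUnit P)).restrictFullyFaithful
    (fullyFaithfulSheafToPresheaf J (Type u)) (Functor.FullyFaithful.id _)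
    (Functor.rightUnitor _).symm (Iso.refl _)

/-- The inverse image functor extends the given functor. -/
noncomputable def toSheavesCompFlatInverseImageIso [HasColimits G] [HasFiniteLimits C]
    [PreservesFiniteLimits P]
    (hP : ∀ ⦃c : C⦄ (S : Sieve c), S ∈ J c → IsLocallySurjectiveOn (P ⋙ e.functor) S) :
    toSheaves J ⋙ flatInverseImage J P ≅ P :=
  -- Sheafification followed by the inverse image, and the Yoneda extension, are both left adjoint
  -- to the restricted Yoneda functor.
  Functor.isoWhiskerLeft uliftYoneda.{u} (Adjunction.leftAdjointUniq
    ((sheafificationAdjunction J (Type u)).comp (flatAdjunction e P hP))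
    (Presheaf.uliftYonedaAdjunction.{u} (uliftYoneda.{u}.leftKanExtension P)
    (uliftYoneda.{u}.leftKanExtensionUnit P))) ≪≫ uliftYonedaCompLeftKanExtensionIso P

lemma preservesFiniteLimits_flatInverseImage [HasColimits G] [HasFiniteLimits C]
    [PreservesFiniteLimits P] (e : G ≌ Sheaf K (Type u)) :
    PreservesFiniteLimits (flatInverseImage J P) := by
  have := preservesFiniteLimits_leftKanExtension_topos e P
  exact comp_preservesFiniteLimits _ _

end Diaconescu

lemma hasColimits_sheaf {C : Type u} [SmallCategory C] (J : GrothendieckTopology C) :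
    HasColimits (Sheaf J (Type u)) :=
  ⟨fun _ _ => Sheaf.instHasColimitsOfShape⟩

namespace Topoi

lemma hasColimits (E : Topoi.{u}) : HasColimits E := by
  obtain ⟨C, _, J, ⟨e⟩⟩ := E.isTopos
  have := hasColimits_sheaf J
  exact CategoryTheory.Adjunction.has_colimits_of_equivalence e.functor

lemma hasLimits (E : Topoi.{u}) : HasLimits E := by
  obtain ⟨C, _, J, ⟨e⟩⟩ := E.isTopos
  exact CategoryTheory.Adjunction.has_limits_of_equivalence e.functor

section

variable {C D : Type u} [SmallCategory C] [SmallCategory D] {J : GrothendieckTopology C}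
  {K : GrothendieckTopology D} {G E : Topoi.{u}} (e : G ≌ Sheaf K (Type u))
  (e' : E ≌ Sheaf J (Type u)) (P : C ⥤ G) [HasFiniteLimits C] [PreservesFiniteLimits P]

/-- The geometric morphism attached to a left exact functor that maps coverings to jointly
locally surjective families. -/
noncomputable def flatGeomMorphism
    (hP : ∀ ⦃c : C⦄ (S : Sieve c), S ∈ J c → IsLocallySurjectiveOn (P ⋙ e.functor) S) :
    G ⟶ E :=
  have := G.hasColimits
  { direct := flatDirectImage J e P hP ⋙ e'.inverse
    inverse := e'.functor ⋙ flatInverseImage J P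
    adj := e'.toAdjunction.comp (flatAdjunction e P hP)
    lex := by
      have := preservesFiniteLimits_flatInverseImage (J := J) P e
      exact comp_preservesFiniteLimits _ _ }

/-- The inverse image functor of `flatGeomMorphism` extends the given functor. -/
noncomputable def compFlatGeomMorphismIso
    (hP : ∀ ⦃c : C⦄ (S : Sieve c), S ∈ J c → IsLocallySurjectiveOn (P ⋙ e.functor) S) :
    (toSheaves J ⋙ e'.inverse) ⋙ (flatGeomMorphism e e' P hP).inverse ≅ P :=
  have := G.hasColimits
  Functor.isoWhiskerLeft (toSheaves J)
    (Functor.isoWhiskerRight e'.counitIso (flatInverseImage J P)) ≪≫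
    toSheavesCompFlatInverseImageIso e P hP

end

end Topoi

/-! ### Right Kan extensions into flatly presented topoi. -/

/-- Transposition along an adjunction preserves unique lifting of transformations. -/
lemma existsUnique_comp_whiskerLeft_eq {D E G : Type*} [Category* D] [Category* E] [Category* G]
    {L : D ⥤ E} {R : E ⥤ D} (adj : L ⊣ R) {T H : E ⥤ G} (θ : T ⟶ H) {A : D ⥤ G}
    (h : ∀ β : R ⋙ A ⟶ H, ∃! σ : R ⋙ A ⟶ T, σ ≫ θ = β) (β : A ⟶ L ⋙ H) :
    ∃! σ : A ⟶ L ⋙ T, σ ≫ Functor.whiskerLeft L θ = β := by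
  let φ (B : E ⥤ G) : (R ⋙ A ⟶ B) ≃ (A ⟶ L ⋙ B) := (adj.whiskerLeft G).homEquiv A B
  have hφ (σ : R ⋙ A ⟶ T) : φ T σ ≫ Functor.whiskerLeft L θ = φ H (σ ≫ θ) :=
    ((adj.whiskerLeft G).homEquiv_naturality_right σ θ).symm
  obtain ⟨σ, hσ, huniq⟩ := h ((φ H).symm β)
  refine ⟨φ T σ, ?_, fun τ hτ => ?_⟩
  · refine (hφ σ).trans ?_
    rw [hσ]
    exact (φ H).apply_symm_apply β
  · rw [← huniq ((φ T).symm τ), Equiv.apply_symm_apply]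
    refine (Equiv.eq_symm_apply _).2 ?_
    rw [← hφ, Equiv.apply_symm_apply]
    exact hτ

/-- A transformation between functors preserving colimits is invertible if it is invertible
on a dense small subcategory. -/
lemma isIso_of_isDense {C : Type u} [SmallCategory C] {E : Type (u + 1)} [Category.{u} E]
    [HasColimits E] {G : Type (u + 1)} [Category.{u} G]
    (F : C ⥤ E) [F.IsDense] {T H : E ⥤ G} [PreservesColimits T] [PreservesColimits H]
    (θ : T ⟶ H) (hθ : ∀ c, IsIso (θ.app (F.obj c))) : IsIso θ := by
  have hH : PreservesDirectedColimits H := fun J _ _ _ => inferInstance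
  have hT : PreservesDirectedColimits T := fun J _ _ _ => inferInstance
  obtain ⟨σ, hσ, -⟩ := existsUnique_comp_eq F θ hθ hH (𝟙 H)
  obtain ⟨τ, -, h⟩ := existsUnique_comp_eq F θ hθ hT θ
  refine ⟨σ, (h _ ?_).trans (h _ ?_).symm, hσ⟩
  · simp [hσ]
  · simp

section

variable {B : Type u} [Bicategory.{w, v} B]

/-- If one right Kan extension is preserved by a 1-cell, then so are all of them. -/
lemma IsRightKanExtension.rightExtensionComp_of_isRightKanExtension {a b c d : B} {i : a ⟶ b}
    {x : a ⟶ c} {t s : RightExtension i x} {g : c ⟶ d}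
    (h : IsRightKanExtension (rightExtensionComp t g)) (ht : IsRightKanExtension t)
    (hs : IsRightKanExtension s) : IsRightKanExtension (rightExtensionComp s g) := by
  obtain ⟨ht⟩ := ht
  obtain ⟨hs⟩ := hs
  let e : t ≅ s := ht.uniqueUpToIso hs
  have he : i ◁ e.hom.left ≫ s.counit = t.counit := RightExtension.w e.hom
  refine h.of_iso (whiskerRightIso ((CostructuredArrow.proj _ _).mapIso e) g) (Iso.refl _) ?_
  change i ◁ (e.hom.left ▷ g) ≫ (α_ i s.extension g).inv ≫ s.counit ▷ g =
    ((α_ i t.extension g).inv ≫ t.counit ▷ g) ≫ 𝟙 _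
  rw [← he, comp_whiskerRight, whisker_assoc]
  simp

/-- A right adjoint is assembled from terminal objects of the comma categories, and invertibility of
the counit does not depend on which terminal object is taken. -/
lemma isRightKanInjective_iff {e a b : B} (i : a ⟶ b) : IsRightKanInjective e i ↔
    ∀ x : a ⟶ e, ∃ t : RightExtension i x, IsRightKanExtension t ∧ IsIso t.counit := by
  constructor
  · rintro ⟨R, adj, _⟩ x
    exact ⟨CostructuredArrow.mk (adj.counit.app x), ⟨mkTerminalOfRightAdjoint _ adj x⟩,
      inferInstanceAs (IsIso (adj.counit.app x))⟩
  · intro h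
    have (x : a ⟶ e) : HasTerminal (CostructuredArrow (precomp e i) x) := by
      obtain ⟨t, ⟨ht⟩, -⟩ := h x
      exact ht.hasTerminal
    let adj := adjunctionOfCostructuredArrowTerminals (precomp e i)
    refine ⟨_, adj, ?_⟩
    have (x : a ⟶ e) : IsIso (adj.counit.app x) := by
      obtain ⟨t, ⟨ht⟩, h⟩ := h x
      let s : RightExtension i x := CostructuredArrow.mk (adj.counit.app x)
      let φ : s ≅ t := (mkTerminalOfRightAdjoint _ adj x).uniqueUpToIso ht
      have hφ : (precomp e i).map φ.hom.left ≫ t.counit = adj.counit.app x :=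
        RightExtension.w φ.hom
      rw [← hφ]
      have : IsIso φ.hom.left := inferInstanceAs (IsIso ((CostructuredArrow.proj _ _).map φ.hom))
      exact IsIso.comp_isIso' (Functor.map_isIso _ _) h
    exact NatIso.isIso_of_isIso_app _

end

namespace Topoi

variable {F G E D : Topoi.{u}} {i : F ⟶ G} {x : F ⟶ E}

/-- The transpose of the counit of a right extension. -/
def rightExtensionMate (t : RightExtension i x) :
    t.extension.inverse ⟶ x.inverse ⋙ i.direct :=
  (i.adj.whiskerRight E).homEquiv t.extension.inverse x.inverse t.counit.app

lemma rightExtensionMate_app (t : RightExtension i x) (X : E) :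
    (rightExtensionMate t).app X = i.adj.homEquiv _ _ (t.counit.app.app X) := by
  have h := congr_app ((i.adj.whiskerRight E).homEquiv_unit t.extension.inverse x.inverse
    t.counit.app) X
  refine h.trans (Eq.trans ?_ (i.adj.homEquiv_unit _ _ (t.counit.app.app X)).symm)
  refine (NatTrans.comp_app _ _ _).trans ?_
  simp
  rfl

/-- Transposition along `i^* ⊣ i_*` turns the universal property into unique lifting through a
single transformation into `x^* ⋙ i_*`, the form supplied by `existsUnique_comp_eq`. -/
lemma isRightKanExtension_iff_mate (t : RightExtension i x) :
    IsRightKanExtension t ↔ ∀ (k : G ⟶ E) (β : k.inverse ⟶ x.inverse ⋙ i.direct),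
      ∃! σ : k.inverse ⟶ t.extension.inverse, σ ≫ rightExtensionMate t = β := by
  have key (k : G ⟶ E) (σ : k ⟶ t.extension) (β : i ≫ k ⟶ x) : i ◁ σ ≫ t.counit = β ↔
      σ.app ≫ rightExtensionMate t = (i.adj.whiskerRight E).homEquiv k.inverse x.inverse β.app := by
    have h := (i.adj.whiskerRight E).homEquiv_naturality_left σ.app t.counit.app
    refine Iff.trans ?_ (Eq.congr_left h)
    refine Iff.trans ?_ (Equiv.apply_eq_iff_eq _).symm
    exact ⟨congrArg GeomMorphism.Hom.app, GeomMorphism.hom_ext⟩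
  rw [isRightKanExtension_iff]
  constructor
  · intro h k β
    obtain ⟨σ, hσ, huniq⟩ := h k ⟨((i.adj.whiskerRight E).homEquiv k.inverse x.inverse).symm β⟩
    refine ⟨σ.app, ?_, fun τ hτ => ?_⟩
    · exact ((key _ _ _).1 hσ).trans (Equiv.apply_symm_apply _ _)
    · refine congrArg GeomMorphism.Hom.app (huniq ⟨τ⟩ ((key _ _ _).2 ?_))
      exact Eq.trans hτ (Equiv.apply_symm_apply _ _).symm
  · intro h k β
    obtain ⟨σ, hσ, huniq⟩ := h k ((i.adj.whiskerRight E).homEquiv k.inverse x.inverse β.app)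
    exact ⟨⟨σ⟩, (key _ _ _).2 hσ, fun τ hτ => GeomMorphism.hom_ext (huniq _ ((key _ _ _).1 hτ))⟩

lemma rightExtensionMate_rightExtensionComp (t : RightExtension i x) (f : E ⟶ D) :
    rightExtensionMate (rightExtensionComp t f) =
      Functor.whiskerLeft f.inverse (rightExtensionMate t) := by
  refine NatTrans.ext (funext fun Y => ?_)
  refine (rightExtensionMate_app _ _).trans (Eq.trans ?_ (rightExtensionMate_app t _).symm)
  exact congrArg _ (Category.id_comp (t.counit.app.app (f.inverse.obj Y)))

lemma preservesFiniteColimits_comp_direct (hi : IsFlat i) :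
    PreservesFiniteColimits (x.inverse ⋙ i.direct) := by
  have : PreservesFiniteColimits i.direct := hi
  have := x.adj.leftAdjoint_preservesColimits
  exact comp_preservesFiniteColimits _ _

/-- A right extension along a flat geometric morphism whose mate is invertible on a dense
subcategory is a right Kan extension preserved by all spartan geometric morphisms. -/
lemma isRightKanExtension_rightExtensionComp (hi : IsFlat i) (t : RightExtension i x)
    {C : Type u} [SmallCategory C] (v : C ⥤ E) [v.IsDense]
    (ht : ∀ c, IsIso ((rightExtensionMate t).app (v.obj c))) {f : E ⟶ D} (hf : IsSpartan f) :
    IsRightKanExtension (rightExtensionComp t f) := by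
  rw [isRightKanExtension_iff_mate, rightExtensionMate_rightExtensionComp]
  intro k β
  have := E.hasColimits
  have := preservesFiniteColimits_comp_direct (x := x) hi
  have := t.extension.adj.leftAdjoint_preservesColimits
  have := k.adj.leftAdjoint_preservesColimits
  -- The source becomes `f_* ⋙ k^*`, which preserves directed colimits because `f` is spartan.
  refine existsUnique_comp_whiskerLeft_eq f.adj (rightExtensionMate t) (fun β' => ?_) β
  refine existsUnique_comp_eq v _ ht (fun J _ _ _ => ?_) β'
  have := hf J
  exact comp_preservesColimitsOfShape _ _

lemma isRightKanExtension_of_isIso_mate (hi : IsFlat i) (t : RightExtension i x)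
    {C : Type u} [SmallCategory C] (v : C ⥤ E) [v.IsDense]
    (ht : ∀ c, IsIso ((rightExtensionMate t).app (v.obj c))) :
    IsRightKanExtension t := by
  rw [isRightKanExtension_iff_mate]
  intro k β
  have := E.hasColimits
  have := preservesFiniteColimits_comp_direct (x := x) hi
  have := t.extension.adj.leftAdjoint_preservesColimits
  have := k.adj.leftAdjoint_preservesColimits
  exact existsUnique_comp_eq v _ ht (fun J _ _ _ => inferInstance) β

/-- A topos is flatly presented if it is the topos of sheaves on a site with finite limits whose
coverings are sent to jointly locally surjective families by all functors to a topos that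
preserve finite limits and finite colimits. -/
def IsFlatlyPresented (E : Topoi.{u}) : Prop :=
  ∃ (C : Type u) (_ : SmallCategory C) (J : GrothendieckTopology C) (_ : HasFiniteLimits C)
    (e : E ≌ Sheaf J (Type u)), ∀ (D : Type u) [SmallCategory D] (K : GrothendieckTopology D)
    (H : E ⥤ Sheaf K (Type u)) [PreservesFiniteLimits H] [PreservesFiniteColimits H]
    ⦃c : C⦄ (S : Sieve c), S ∈ J c →
      IsLocallySurjectiveOn ((toSheaves J ⋙ e.inverse) ⋙ H) S

namespace IsFlatlyPresented

lemma exists_rightExtension (hE : IsFlatlyPresented E) (hi : IsFlat i) (x : F ⟶ E) :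
    ∃ (t : RightExtension i x) (C : Type u) (_ : SmallCategory C) (v : C ⥤ E) (_ : v.IsDense),
      ∀ c, IsIso ((rightExtensionMate t).app (v.obj c)) := by
  obtain ⟨C, _, J, _, e', hJ⟩ := hE
  obtain ⟨D, _, K, ⟨e⟩⟩ := G.isTopos
  let H : E ⥤ G := x.inverse ⋙ i.direct
  have := x.lex
  have := i.adj.rightAdjoint_preservesLimits
  have : PreservesFiniteColimits H := preservesFiniteColimits_comp_direct hi
  have : PreservesFiniteLimits H := comp_preservesFiniteLimits _ _
  let v : C ⥤ E := toSheaves J ⋙ e'.inverse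
  have : v.IsDense := isDense_comp_of_reflective _ e'.symm.toAdjunction
  have : PreservesFiniteLimits v := comp_preservesFiniteLimits _ _
  have : PreservesFiniteLimits (v ⋙ H) := comp_preservesFiniteLimits _ _
  have : PreservesFiniteLimits (H ⋙ e.functor) := comp_preservesFiniteLimits _ _
  have : PreservesFiniteColimits (H ⋙ e.functor) := comp_preservesFiniteColimits _ _
  have hP : ∀ ⦃c : C⦄ (S : Sieve c), S ∈ J c → IsLocallySurjectiveOn ((v ⋙ H) ⋙ e.functor) S :=
    fun c S hS => hJ D K (H ⋙ e.functor) S hS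
  let T := flatGeomMorphism e e' (v ⋙ H) hP
  let φ : v ⋙ T.inverse ≅ v ⋙ H := compFlatGeomMorphismIso e e' (v ⋙ H) hP
  have := T.adj.leftAdjoint_preservesColimits
  -- `T.inverse` preserves colimits, so the isomorphism `φ` on the site extends to a transformation,
  -- in general not invertible.
  obtain ⟨θ, hθ, -⟩ := existsUnique_whiskerLeft_eq v T.inverse H φ.hom
  let t : RightExtension i x := RightExtension.mk T
    ⟨((i.adj.whiskerRight E).homEquiv T.inverse x.inverse).symm θ⟩
  have ht : rightExtensionMate t = θ := Equiv.apply_symm_apply _ _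
  refine ⟨t, C, inferInstance, v, inferInstance, fun c => ?_⟩
  rw [ht, hθ]
  infer_instance

lemma preservesRightKanExtensions (hE : IsFlatlyPresented E) (hi : IsFlat i) {f : E ⟶ D}
    (hf : IsSpartan f) : PreservesRightKanExtensions f i := by
  intro x s hs
  obtain ⟨t, C, _, v, _, hv⟩ := hE.exists_rightExtension hi x
  have ht := isRightKanExtension_of_isIso_mate hi t v hv
  have htf := isRightKanExtension_rightExtensionComp hi t v hv hf
  exact htf.rightExtensionComp_of_isRightKanExtension ht hs

lemma isFlatComplete (hE : IsFlatlyPresented E) : IsFlatComplete E := by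
  intro F G i hi
  rw [isRightKanInjective_iff]
  intro x
  obtain ⟨t, C, _, v, _, hv⟩ := hE.exists_rightExtension hi.2 x
  refine ⟨t, isRightKanExtension_of_isIso_mate hi.2 t v hv, ?_⟩
  have := hi.1.1
  have := hi.1.2
  have := E.hasColimits
  have := x.adj.leftAdjoint_preservesColimits
  have := (i ≫ t.extension).adj.leftAdjoint_preservesColimits
  -- Both sides are inverse images, so the dense subcategory suffices. There the counit is `i^*` of
  -- the invertible mate followed by the counit of `i^* ⊣ i_*`, which is invertible for an
  -- embedding.
  have : IsIso t.counit.app := by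
    refine isIso_of_isDense v _ fun c => ?_
    have h : t.counit.app.app (v.obj c) =
        i.inverse.map ((rightExtensionMate t).app (v.obj c)) ≫ i.adj.counit.app _ := by
      rw [rightExtensionMate_app]
      exact ((i.adj.homEquiv_counit _ _ _).symm.trans (Equiv.symm_apply_apply _ _)).symm
    rw [h]
    have := hv c
    exact IsIso.comp_isIso' (Functor.map_isIso i.inverse _) inferInstance
  exact (GeomMorphism.isoMk (asIso t.counit.app)).isIso_hom

end IsFlatlyPresented

end Topoi

/-! ### Local description of colimits of sheaves. -/

section SheafColimits

open Opposite

variable {D : Type u} [SmallCategory D] {K : GrothendieckTopology D}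

/-- Joint local surjectivity is transitive. -/
lemma JointlyLocallySurjective.trans {ι : Type*} {X : Sheaf K (Type u)}
    {U : ι → Sheaf K (Type u)} {p : ∀ i, U i ⟶ X} (hp : JointlyLocallySurjective p)
    {κ : ι → Type*} {V : ∀ i, κ i → Sheaf K (Type u)} {q : ∀ i j, V i j ⟶ U i}
    (hq : ∀ i, JointlyLocallySurjective (q i))
    {l : Type*} {W : l → Sheaf K (Type u)} {r : ∀ k, W k ⟶ X}
    (h : ∀ i j, ∃ (k : l) (m : V i j ⟶ W k), q i j ≫ p i = m ≫ r k) :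
    JointlyLocallySurjective r := by
  intro d y
  refine K.transitive (hp d y) _ fun d' t ⟨i, z, hz⟩ => ?_
  refine K.superset_covering (fun d'' s hs => ?_) (hq i d' z)
  obtain ⟨j, w, hw⟩ := hs
  obtain ⟨k, m, hm⟩ := h i j
  refine ⟨k, m.hom.app _ w, ?_⟩
  have h1 := congr($(hm).hom.app _ w)
  refine h1.symm.trans ?_
  change (p i).hom.app _ ((q i j).hom.app _ w) = _
  rw [hw, NatTrans.naturality_apply, hz]
  simp

lemma jointlyLocallySurjective_of_epi {X Y : Sheaf K (Type u)} (f : X ⟶ Y) [Epi f] :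
    JointlyLocallySurjective fun _ : Unit => f := by
  intro d y
  have : Sheaf.IsLocallySurjective f := (Sheaf.isLocallySurjective_iff_epi f).2 inferInstance
  refine K.superset_covering (fun d' t ht => ?_)
    (@Presheaf.imageSieve_mem _ _ K _ _ _ _ _ _ _ _ f.hom this (op d) y)
  obtain ⟨z, hz⟩ := ht
  exact ⟨(), z, hz⟩

variable {I : Type*} [Category* I] [HasColimitsOfShape I (Type u)] {F : I ⥤ Sheaf K (Type u)}
  {t : Cocone F} (ht : IsColimit t)

/-- A colimit of sheaves is locally bijective to the colimit of the underlying presheaves. -/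
lemma exists_toSheafify_of_isColimit (ht : IsColimit t) :
    ∃ (φ : colimit (F ⋙ sheafToPresheaf K (Type u)) ⟶ t.pt.obj),
      Presheaf.IsLocallyInjective K φ ∧ Presheaf.IsLocallySurjective K φ ∧
      ∀ k, colimit.ι (F ⋙ sheafToPresheaf K (Type u)) k ≫ φ = (t.ι.app k).hom := by
  let t₀ := colimit.cocone (F ⋙ sheafToPresheaf K (Type u))
  let ht₀ : IsColimit t₀ := colimit.isColimit _
  let φ := (Sheaf.isColimitSheafifyCocone t₀ ht₀).coconePointUniqueUpToIso ht
  have hφ (k : I) : (Sheaf.sheafifyCocone t₀).ι.app k ≫ φ.hom = t.ι.app k :=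
    IsColimit.comp_coconePointUniqueUpToIso_hom _ _ _
  let ψ : sheafify K (colimit (F ⋙ sheafToPresheaf K (Type u))) ≅ t.pt.obj :=
    (sheafToPresheaf K (Type u)).mapIso φ
  refine ⟨toSheafify K _ ≫ ψ.hom, ?_, ?_, fun k => ?_⟩
  · have : Presheaf.IsLocallyInjective K ψ.hom :=
      inferInstanceAs (Sheaf.IsLocallyInjective φ.hom)
    exact Presheaf.isLocallyInjective_comp K _ _
  · have : Presheaf.IsLocallySurjective K ψ.hom :=
      inferInstanceAs (Sheaf.IsLocallySurjective φ.hom)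
    exact Presheaf.isLocallySurjective_comp K _ _
  · rw [← hφ k]
    exact (Category.assoc _ _ _).symm.trans
      (congrArg (· ≫ ψ.hom) (Sheaf.sheafifyCocone_ι_app_val t₀ k).symm)

include ht

lemma jointlyLocallySurjective_ι_of_isColimit : JointlyLocallySurjective t.ι.app := by
  intro d y
  obtain ⟨φ, -, _, hφ⟩ := exists_toSheafify_of_isColimit ht
  refine K.superset_covering (fun d' s hs => ?_) (Presheaf.imageSieve_mem K φ (U := op d) y)
  obtain ⟨z, hz⟩ := hs
  obtain ⟨k, w, hw⟩ := Types.jointly_surjective_of_isColimit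
    (isColimitOfPreserves ((evaluation _ _).obj (op d'))
      (colimit.isColimit (F ⋙ sheafToPresheaf K (Type u)))) z
  refine ⟨k, w, Eq.trans ?_ hz⟩
  rw [← hw, ← hφ]
  rfl

/-- Sections of a diagram of sheaves with the same image in the colimit are locally connected
by the transition morphisms of the diagram. -/
lemma exists_eqvGen_of_isColimit {d : D} {k k' : I} (b : (F.obj k).obj.obj (op d))
    (b' : (F.obj k').obj.obj (op d))
    (h : (t.ι.app k).hom.app _ b = (t.ι.app k').hom.app _ b') :
    ∃ S ∈ K d, ∀ ⦃d' : D⦄ (s : d' ⟶ d), S s → Relation.EqvGen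
      (Functor.ColimitTypeRel (F ⋙ sheafToPresheaf K (Type u) ⋙ (evaluation _ _).obj (op d')))
      ⟨k, (F.obj k).obj.map s.op b⟩ ⟨k', (F.obj k').obj.map s.op b'⟩ := by
  obtain ⟨φ, _, -, hφ⟩ := exists_toSheafify_of_isColimit ht
  rw [← hφ, ← hφ] at h
  refine ⟨_, Presheaf.equalizerSieve_mem K φ _ _ h, fun d' s hs => ?_⟩
  replace hs : (colimit (F ⋙ sheafToPresheaf K (Type u))).map s.op
      ((colimit.ι (F ⋙ sheafToPresheaf K (Type u)) k).app _ b) =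
      (colimit (F ⋙ sheafToPresheaf K (Type u))).map s.op
      ((colimit.ι (F ⋙ sheafToPresheaf K (Type u)) k').app _ b') := hs
  rw [← NatTrans.naturality_apply, ← NatTrans.naturality_apply] at hs
  apply Types.colimit_eq
  let e := (isColimitOfPreserves ((evaluation _ _).obj (op d'))
      (colimit.isColimit (F ⋙ sheafToPresheaf K (Type u)))).coconePointUniqueUpToIso
      (colimit.isColimit _)
  have he (k : I) := IsColimit.comp_coconePointUniqueUpToIso_hom (isColimitOfPreserves
    ((evaluation _ _).obj (op d')) (colimit.isColimit (F ⋙ sheafToPresheaf K (Type u))))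
      (colimit.isColimit _) k
  have he' (k : I) (z) := congr($(he k) z)
  exact (he' _ _).symm.trans ((congrArg e.hom hs).trans (he' _ _))

end SheafColimits

/-! ### Coherent topoi are flatly presented. -/

section Coherent

open Opposite

variable {C : Type u} [SmallCategory C] {J : GrothendieckTopology C}

lemma toSheaves_hom_ext {c : C} {S : Sieve c} (hS : S ∈ J c) {X : Sheaf J (Type u)}
    {m m' : (toSheaves J).obj c ⟶ X}
    (h : ∀ ⦃c' : C⦄ (f : c' ⟶ c), S f → (toSheaves J).map f ≫ m = (toSheaves J).map f ≫ m') :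
    m = m' := by
  let adj := sheafificationAdjunction J (Type u)
  refine (adj.homEquiv (uliftYoneda.{u}.obj c) X).injective (uliftYonedaEquiv.{u}.injective ?_)
  refine sheaf_separated X hS fun c' f hf => ?_
  have key (m : (toSheaves J).obj c ⟶ X) :
      X.obj.map f.op (uliftYonedaEquiv.{u} (adj.homEquiv (uliftYoneda.{u}.obj c) X m)) =
      uliftYonedaEquiv.{u} (adj.homEquiv (uliftYoneda.{u}.obj c') X ((toSheaves J).map f ≫ m)) :=
    (uliftYonedaEquiv_naturality _ f.op).trans
      (congrArg uliftYonedaEquiv.{u} (adj.homEquiv_naturality_left _ m).symm)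
  exact (key m).trans ((congrArg (fun q => uliftYonedaEquiv.{u} (adj.homEquiv _ X q))
    (h f hf)).trans (key m').symm)

namespace Topoi

lemma IsCoherent.isFlatlyPresented {E : Topoi.{u}} (hE : IsCoherent E) :
    IsFlatlyPresented E := by
  obtain ⟨C, _, J, _, hJ, ⟨e⟩⟩ := hE
  refine ⟨C, inferInstance, J, inferInstance, e, fun D _ K H _ _ c S hS => ?_⟩
  obtain ⟨n, Y, f, hf, hS'⟩ := hJ c S hS
  have := E.hasColimits
  let v : C ⥤ E := toSheaves J ⋙ e.inverse
  -- Finiteness of the covering enters here: `H` preserves this coproduct and the epimorphism `π`.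
  let π : ∐ (fun k => v.obj (Y k)) ⟶ v.obj c := Sigma.desc fun k => v.map (f k)
  have : Epi π := by
    refine ⟨fun {Z} m m' h => ?_⟩
    refine (e.symm.toAdjunction.homEquiv _ Z).injective (toSheaves_hom_ext hS' ?_)
    rintro c' _ ⟨c'', g, _, ⟨k⟩, rfl⟩
    have hk : v.map (f k) ≫ m = v.map (f k) ≫ m' := by
      simpa [π] using Sigma.ι _ k ≫= h
    have key (m : v.obj c ⟶ Z) :
        (toSheaves J).map (g ≫ f k) ≫ e.symm.toAdjunction.homEquiv ((toSheaves J).obj c) Z m =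
        (toSheaves J).map g ≫ e.symm.toAdjunction.homEquiv _ Z (v.map (f k) ≫ m) := by
      rw [Functor.map_comp, Category.assoc]
      exact congrArg _ (e.symm.toAdjunction.homEquiv_naturality_left _ m).symm
    rw [key, key, hk]
  have hcol : IsColimit (H.mapCocone (colimit.cocone (Discrete.functor fun k => v.obj (Y k)))) :=
    isColimitOfPreserves H (colimit.isColimit _)
  refine (jointlyLocallySurjective_of_epi (H.map π)).trans
    (fun _ => jointlyLocallySurjective_ι_of_isColimit hcol) fun _ ⟨k⟩ =>
      ⟨⟨Y k, f k, hf k⟩, 𝟙 _, ?_⟩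
  refine (H.map_comp _ _).symm.trans (Eq.trans ?_ (Category.id_comp _).symm)
  exact congrArg H.map (Sigma.ι_desc _ _)

end Topoi

end Coherent

/-! ### A small dense subcategory with finite limits and enough coverings. -/

section SmallClosure

variable {C₀ : Type u} [SmallCategory C₀] {E : Type (u + 1)} [Category.{u} E] (v : C₀ ⥤ E)
  [HasLimits E] [HasColimits E]

/-- The objects obtained from those satisfying `P` by one formation of a pullback, or of
a coproduct of objects `v.obj d` over a set of morphisms to an object satisfying `P`. -/
def addPullbacksCoproducts (P : ObjectProperty E) : ObjectProperty E :=
  P ⊔ ObjectProperty.ofObj (fun x : Σ X Y Z : Subtype P, (X.1 ⟶ Z.1) × (Y.1 ⟶ Z.1) =>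
      pullback x.2.2.2.1 x.2.2.2.2) ⊔
    ObjectProperty.ofObj (fun x : Σ X : Subtype P, Set (Σ d, v.obj d ⟶ X.1) =>
      ∐ fun s : x.2 => v.obj s.1.1)

instance (P : ObjectProperty E) [ObjectProperty.Small.{u} P] :
    ObjectProperty.Small.{u} (addPullbacksCoproducts v P) := by
  have : Small.{u} (Subtype P) := inferInstanceAs (ObjectProperty.Small.{u} P)
  unfold addPullbacksCoproducts
  infer_instance

/-- The finite iterates of `addPullbacksCoproducts`. -/
def closureIterate : ℕ → ObjectProperty E
  | 0 => ObjectProperty.ofObj v.obj ⊔ ObjectProperty.ofObj fun _ : Unit => ⊤_ E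
  | n + 1 => addPullbacksCoproducts v (closureIterate n)

instance (n : ℕ) : ObjectProperty.Small.{u} (closureIterate v n) := by
  induction n with
  | zero => unfold closureIterate; infer_instance
  | succ n _ => unfold closureIterate; infer_instance

lemma closureIterate_monotone : Monotone (closureIterate v) :=
  monotone_nat_of_le_succ fun _ => le_sup_left.trans le_sup_left

/-- The closure of the objects `v.obj d` and the terminal object under pullbacks and certain
small coproducts of objects `v.obj d`. -/
def smallClosure : ObjectProperty E := ⨆ n, closureIterate v n

instance : ObjectProperty.Small.{u} (smallClosure v) := by
  unfold smallClosure; infer_instance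

lemma smallClosure_iff (X : E) : smallClosure v X ↔ ∃ n, closureIterate v n X := by
  simp [smallClosure]

lemma smallClosure_obj (d : C₀) : smallClosure v (v.obj d) :=
  (smallClosure_iff v _).2 ⟨0, Or.inl ⟨d⟩⟩

lemma smallClosure_terminal : smallClosure v (⊤_ E) :=
  (smallClosure_iff v _).2 ⟨0, Or.inr ⟨()⟩⟩

lemma smallClosure_pullback {X Y Z : E} (f : X ⟶ Z) (g : Y ⟶ Z) (hX : smallClosure v X)
    (hY : smallClosure v Y) (hZ : smallClosure v Z) : smallClosure v (pullback f g) := by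
  rw [smallClosure_iff] at *
  obtain ⟨a, ha⟩ := hX
  obtain ⟨b, hb⟩ := hY
  obtain ⟨c, hc⟩ := hZ
  replace ha := closureIterate_monotone v (show a ≤ a + b + c by omega) _ ha
  replace hb := closureIterate_monotone v (show b ≤ a + b + c by omega) _ hb
  replace hc := closureIterate_monotone v (show c ≤ a + b + c by omega) _ hc
  exact ⟨a + b + c + 1, Or.inl (Or.inr (ObjectProperty.ofObj_apply _
    (⟨⟨X, ha⟩, ⟨Y, hb⟩, ⟨Z, hc⟩, f, g⟩ : Σ X Y Z : Subtype (closureIterate v (a + b + c)),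
      (X.1 ⟶ Z.1) × (Y.1 ⟶ Z.1))))⟩

lemma smallClosure_coproduct {X : E} (hX : smallClosure v X) (S : Set (Σ d, v.obj d ⟶ X)) :
    smallClosure v (∐ fun s : S => v.obj s.1.1) := by
  rw [smallClosure_iff] at *
  obtain ⟨a, ha⟩ := hX
  exact ⟨a + 1, Or.inr (ObjectProperty.ofObj_apply _
    (⟨⟨X, ha⟩, S⟩ : Σ X : Subtype (closureIterate v a), Set (Σ d, v.obj d ⟶ X.1)))⟩

/-- The inclusion of the closure creates finite limits. -/
lemma nonempty_createsFiniteLimits_smallClosure :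
    Nonempty (CreatesFiniteLimits (smallClosure v).ι) := by
  have : CreatesLimitsOfShape (Discrete PEmpty) (smallClosure v).ι := ⟨fun {K} =>
    createsLimitOfFullyFaithfulOfIso ⟨⊤_ E, smallClosure_terminal v⟩
      (HasLimit.isoOfNatIso (Functor.emptyExt _ _))⟩
  have : CreatesLimitsOfShape WalkingCospan (smallClosure v).ι := ⟨fun {K} =>
    createsLimitOfFullyFaithfulOfIso
      ⟨pullback (K.map WalkingCospan.Hom.inl).hom (K.map WalkingCospan.Hom.inr).hom,
        smallClosure_pullback v _ _ (K.obj _).property (K.obj _).property (K.obj _).property⟩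
      (HasLimit.isoOfNatIso (diagramIsoCospan (K ⋙ (smallClosure v).ι)).symm)⟩
  exact ⟨createsFiniteLimitsOfCreatesTerminalAndPullbacks _⟩

lemma exists_desc_smallClosure (c : (smallClosure v).FullSubcategory) {X : E} (q : X ⟶ c.obj) :
    ∃ (c' : (smallClosure v).FullSubcategory) (p : c'.obj ⟶ X),
      ∀ (d : C₀) (h : v.obj d ⟶ X), ∃ k : v.obj d ⟶ c'.obj, k ≫ p ≫ q = h ≫ q := by
  -- The coproduct is indexed by maps to `c.obj` that factor through `q`, not by maps to `X`: `X`
  -- ranges over all of `E`, while such index sets form a small family, which keeps the closure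
  -- small.
  let S : Set (Σ d, v.obj d ⟶ c.obj) := {s | ∃ h : v.obj s.1 ⟶ X, h ≫ q = s.2}
  refine ⟨⟨_, smallClosure_coproduct v c.property S⟩, Sigma.desc fun s : S => s.2.choose,
    fun d h => ⟨Sigma.ι (fun s : S => v.obj s.1.1) ⟨⟨d, h ≫ q⟩, h, rfl⟩, ?_⟩⟩
  rw [Sigma.ι_desc_assoc]
  exact Exists.choose_spec (⟨h, rfl⟩ : ∃ h' : v.obj d ⟶ X, h' ≫ q = h ≫ q)

/-- A dense subcategory is contained in a small full dense subcategory closed under finite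
limits that covers all subobjects of its objects. -/
lemma exists_fullyFaithful_isDense_epi [v.IsDense] :
    ∃ (C : Type u) (_ : SmallCategory C) (_ : HasFiniteLimits C) (w : C ⥤ E) (_ : w.Full)
      (_ : w.Faithful) (_ : w.IsDense) (_ : PreservesFiniteLimits w),
      ∀ (c : C) (X : E) (q : X ⟶ w.obj c), ∃ (c' : C) (p : w.obj c' ⟶ X),
        Epi (pullback.fst q (p ≫ q)) := by
  let P := smallClosure v
  let e := equivSmallModel.{u} P.FullSubcategory
  let w := e.inverse ⋙ P.ι
  obtain ⟨_⟩ := nonempty_createsFiniteLimits_smallClosure v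
  have hP : HasFiniteLimits P.FullSubcategory :=
    ⟨fun J _ _ => hasLimitsOfShape_of_hasLimitsOfShape_createsLimitsOfShape P.ι⟩
  have : PreservesFiniteLimits P.ι := ⟨fun J _ _ => inferInstance⟩
  have : HasFiniteLimits (SmallModel.{u} P.FullSubcategory) :=
    ⟨fun J _ _ => Adjunction.hasLimitsOfShape_of_equivalence e.inverse⟩
  have : PreservesFiniteLimits w := comp_preservesFiniteLimits _ _
  have : (P.lift v (smallClosure_obj v) ⋙ P.ι).IsDense := inferInstanceAs v.IsDense
  have : P.ι.IsDense := isDense_of_isDense_comp (P.lift v (smallClosure_obj v)) P.ι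
  refine ⟨_, inferInstance, inferInstance, w, inferInstance, inferInstance, inferInstance,
    inferInstance, fun c X q => ?_⟩
  obtain ⟨c', p, hp⟩ := exists_desc_smallClosure v (e.inverse.obj c) q
  let i : w.obj (e.functor.obj c') ≅ c'.obj := P.ι.mapIso (e.unitIso.app c').symm
  -- Every `k : v.obj d ⟶ X` lifts to the pullback, and by density such maps detect equality.
  refine ⟨e.functor.obj c', i.hom ≫ p, ⟨fun m m' h => Functor.IsDense.hom_ext v fun d k => ?_⟩⟩
  obtain ⟨l, hl⟩ := hp d k
  have hk := pullback.lift k (l ≫ i.inv) (by simp [hl]) ≫= h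
  rwa [pullback.lift_fst_assoc, pullback.lift_fst_assoc] at hk

end SmallClosure

/-! ### The flat topology and the embedding into a flatly presented topos. -/

section FlatTopology

open Opposite

variable {C : Type u} [SmallCategory C] {E : Type (u + 1)} [Category.{u} E] (w : C ⥤ E)

/-- A sieve is flatly covering if all functors to a topos that preserve finite limits and
finite colimits map it to a jointly locally surjective family. -/
def IsFlatlyCovering {c : C} (S : Sieve c) : Prop :=
  ∀ (D : Type u) [SmallCategory D] (K : GrothendieckTopology D) (H : E ⥤ Sheaf K (Type u))
    [PreservesFiniteLimits H] [PreservesFiniteColimits H], IsLocallySurjectiveOn (w ⋙ H) S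

/-- The Grothendieck topology of flatly covering sieves. -/
def flatTopology [HasPullbacks C] [PreservesFiniteLimits w] : GrothendieckTopology C where
  sieves c := {S | IsFlatlyCovering w S}
  top_mem' c D _ K H _ _ d y := by
    refine K.superset_covering (fun d' t _ => ?_) (K.top_mem d)
    refine ⟨⟨c, 𝟙 c, trivial⟩, (H.obj (w.obj c)).obj.map t.op y, ?_⟩
    have h : H.map (w.map (𝟙 c)) = 𝟙 _ := by simp
    exact congr($(h).hom.app _ _)
  pullback_stable' c c' S g hS D _ K H _ _ d y := by
    refine K.superset_covering (fun d' t ht => ?_) (hS D K H d ((H.map (w.map g)).hom.app _ y))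
    obtain ⟨⟨c'', f, hf⟩, z, hz⟩ := ht
    have : PreservesFiniteLimits (w ⋙ H) := comp_preservesFiniteLimits _ _
    obtain ⟨x, -, hx⟩ := exists_pullback_section
      ((IsPullback.of_hasPullback f g).map (w ⋙ H)) z ((H.obj (w.obj c')).obj.map t.op y)
      (hz.trans (NatTrans.naturality_apply _ _ _).symm)
    refine ⟨⟨pullback f g, pullback.snd f g, ?_⟩, x, hx⟩
    change S (pullback.snd f g ≫ g)
    rw [← pullback.condition]
    exact S.downward_closed hf _
  transitive' c S hS R hR D _ K H _ _ :=
    (hS D K H).trans (fun i => hR i.2.2 D K H)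
      fun i j => ⟨⟨j.1, j.2.1 ≫ i.2.1, j.2.2⟩, 𝟙 _, by simp⟩

variable {w}

lemma pullback_section_ext {D : Type u} [SmallCategory D] {K : GrothendieckTopology D}
    {X Y Z W : Sheaf K (Type u)} {a : W ⟶ X} {b : W ⟶ Y} {f : X ⟶ Z} {g : Y ⟶ Z}
    (h : IsPullback a b f g) {d : D} {x y : W.obj.obj (op d)}
    (hx : a.hom.app _ x = a.hom.app _ y) (hy : b.hom.app _ x = b.hom.app _ y) : x = y := by
  have h1 := (h.map (sheafToPresheaf K (Type u))).map ((evaluation _ _).obj (op d))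
  rw [Types.isPullback_iff] at h1
  exact h1.2.1 x y ⟨hx, hy⟩

/-- Every subobject of `w.obj c` is covered by some `w.obj c'`. -/
lemma exists_liftSieve_map_mem [HasPullbacks E] [w.Full]
    (hw : ∀ (c : C) (X : E) (q : X ⟶ w.obj c), ∃ (c' : C) (p : w.obj c' ⟶ X),
        Epi (pullback.fst q (p ≫ q))) {c : C} {X : E} (q : X ⟶ w.obj c) :
    ∃ (c' : C) (f : c' ⟶ c) (p : w.obj c' ⟶ X), w.map f = p ≫ q ∧
      ∀ (D : Type u) [SmallCategory D] (K : GrothendieckTopology D) (H : E ⥤ Sheaf K (Type u))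
        [PreservesFiniteLimits H] [PreservesFiniteColimits H] (d : D)
        (x : (H.obj X).obj.obj (op d)),
        liftSieve (fun _ : Unit => H.map (w.map f)) ((H.map q).hom.app _ x) ∈ K d := by
  obtain ⟨c', p, hp⟩ := hw c X q
  refine ⟨c', w.preimage (p ≫ q), p, w.map_preimage _, fun D _ K H _ _ d x => ?_⟩
  rw [w.map_preimage]
  refine K.superset_covering (fun d' t ht => ?_)
    (jointlyLocallySurjective_of_epi (H.map (pullback.fst q (p ≫ q))) d x)
  obtain ⟨⟨⟩, z, hz⟩ := ht
  refine ⟨(), (H.map (pullback.snd q (p ≫ q))).hom.app _ z, ?_⟩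
  have h : H.map (pullback.fst q (p ≫ q)) ≫ H.map q =
      H.map (pullback.snd q (p ≫ q)) ≫ H.map (p ≫ q) := by
    rw [← H.map_comp, pullback.condition, H.map_comp]
  rw [← NatTrans.naturality_apply, ← hz]
  exact congr($(h).hom.app _ z).symm

/-- Sections connected by the transition morphisms of a diagram `F ⋙ H` have a common
refinement on which all cocones agree. -/
lemma exists_of_eqvGen [HasPullbacks E] {I : Type*} [Category* I] {F : I ⥤ E} {A : Type*}
    [Category* A] {T : E ⥤ A} (τ : Cocone (F ⋙ T)) {D : Type u} [SmallCategory D]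
    {K : GrothendieckTopology D} (H : E ⥤ Sheaf K (Type u)) [PreservesFiniteLimits H] {d : D}
    {k k' : I} {b : (H.obj (F.obj k)).obj.obj (op d)} {b' : (H.obj (F.obj k')).obj.obj (op d)}
    (h : Relation.EqvGen (Functor.ColimitTypeRel
      ((F ⋙ H) ⋙ sheafToPresheaf K (Type u) ⋙ (evaluation _ _).obj (op d))) ⟨k, b⟩ ⟨k', b'⟩) :
    ∃ (X : E) (r : X ⟶ F.obj k) (s : X ⟶ F.obj k') (z : (H.obj X).obj.obj (op d)),
      T.map r ≫ τ.ι.app k = T.map s ≫ τ.ι.app k' ∧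
      (H.map r).hom.app _ z = b ∧ (H.map s).hom.app _ z = b' := by
  suffices key : ∀ a b : Σ k : I, (H.obj (F.obj k)).obj.obj (op d),
      Relation.EqvGen (Functor.ColimitTypeRel
        ((F ⋙ H) ⋙ sheafToPresheaf K (Type u) ⋙ (evaluation _ _).obj (op d))) a b →
      ∃ (X : E) (r : X ⟶ F.obj a.1) (s : X ⟶ F.obj b.1) (z : (H.obj X).obj.obj (op d)),
        T.map r ≫ τ.ι.app a.1 = T.map s ≫ τ.ι.app b.1 ∧
        (H.map r).hom.app _ z = a.2 ∧ (H.map s).hom.app _ z = b.2 from key ⟨k, b⟩ ⟨k', b'⟩ h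
  intro a b h
  induction h with
  | rel a b h =>
    obtain ⟨φ, hφ⟩ := h
    refine ⟨F.obj a.1, 𝟙 _, F.map φ, a.2, ?_, ?_, hφ.symm⟩
    · rw [T.map_id, Category.id_comp]
      exact (τ.w φ).symm
    · exact congr($(H.map_id (F.obj a.1)).hom.app _ a.2)
  | refl a =>
    refine ⟨F.obj a.1, 𝟙 _, 𝟙 _, a.2, rfl, ?_, ?_⟩ <;>
    exact congr($(H.map_id (F.obj a.1)).hom.app _ a.2)
  | symm a b _ h =>
    obtain ⟨X, r, s, z, h1, h2, h3⟩ := h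
    exact ⟨X, s, r, z, h1.symm, h3, h2⟩
  | trans a b c _ _ h h' =>
    obtain ⟨X, r, s, z, h1, h2, h3⟩ := h
    obtain ⟨X', r', s', z', h1', h2', h3'⟩ := h'
    -- Two spans are composed by a pullback, which `H` preserves.
    obtain ⟨x, hx, hx'⟩ := exists_pullback_section
      ((IsPullback.of_hasPullback s r').map H) z z' (h3.trans h2'.symm)
    refine ⟨pullback s r', pullback.fst s r' ≫ r, pullback.snd s r' ≫ s', x, ?_, ?_, ?_⟩
    · rw [T.map_comp, T.map_comp, Category.assoc, Category.assoc, h1, ← h1',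
        ← T.map_comp_assoc, ← T.map_comp_assoc, pullback.condition]
    · rw [H.map_comp, ← h2, ← hx]; rfl
    · rw [H.map_comp, ← h3', ← hx']; rfl

section

variable [HasFiniteLimits C] [PreservesFiniteLimits w]
  {D₀ : Type u} [SmallCategory D₀] {K₀ : GrothendieckTopology D₀} (e : E ≌ Sheaf K₀ (Type u))

lemma isLocallySurjectiveOn_of_mem_flatTopology {c : C} (S : Sieve c)
    (hS : S ∈ flatTopology w c) : IsLocallySurjectiveOn (w ⋙ e.functor) S :=
  hS D₀ K₀ e.functor

variable (w) in
/-- The direct image functor to the sheaves for the flat topology. -/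
noncomputable def flatTopologyDirectImage : E ⥤ Sheaf (flatTopology w) (Type u) :=
  flatDirectImage (flatTopology w) e w fun _ S hS =>
    isLocallySurjectiveOn_of_mem_flatTopology e S hS

/-- The section of the direct image of `Y` attached to a morphism to `Y`. -/
def flatTopologySection {c : C} {Y : E} (a : w.obj c ⟶ Y) :
    ((flatTopologyDirectImage w e).obj Y).obj.obj (op c) :=
  ULift.up a

variable [HasFiniteLimits E] [w.Full]
  (hw : ∀ (c : C) (X : E) (q : X ⟶ w.obj c), ∃ (c' : C) (p : w.obj c' ⟶ X),
    Epi (pullback.fst q (p ≫ q))) {I : Type} [SmallCategory I] [FinCategory I] {F : I ⥤ E}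

include hw

/-- A section is a map `y : w.obj c ⟶ t.pt`. Any test functor `H` preserves the colimit, so sections
of `H (w.obj c)` locally come from the pullbacks of `y` along the legs of `t`; by `hw` these are
covered by objects of `C`, on which `y` factors through a leg. -/
lemma jointlyLocallySurjective_flatTopologyDirectImage_map {t : Cocone F} (ht : IsColimit t) :
    JointlyLocallySurjective fun k => (flatTopologyDirectImage w e).map (t.ι.app k) := by
  intro c y D _ K H _ _ d z
  refine K.transitive (jointlyLocallySurjective_ι_of_isColimit (isColimitOfPreserves H ht) d
    ((H.map y.down).hom.app _ z)) _ fun d' s hs => ?_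
  obtain ⟨k, b, hb⟩ := hs
  obtain ⟨x, hx, hx'⟩ := exists_pullback_section
    ((IsPullback.of_hasPullback (t.ι.app k) y.down).map H) b ((H.obj _).obj.map s.op z)
    (hb.trans (NatTrans.naturality_apply _ _ _).symm)
  obtain ⟨c', f, p, hf, hcov⟩ := exists_liftSieve_map_mem hw (pullback.snd (t.ι.app k) y.down)
  refine K.superset_covering (fun d'' s' hs' => ?_) (hcov D K H d' x)
  obtain ⟨⟨⟩, ζ, hζ⟩ := hs'
  refine ⟨⟨c', f, k, ULift.up (p ≫ pullback.fst _ _), ?_⟩, ζ, ?_⟩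
  · apply ULift.down_injective
    change (p ≫ pullback.fst _ _) ≫ t.ι.app k = w.map f ≫ y.down
    rw [hf, Category.assoc, Category.assoc, pullback.condition]
  · rw [hx'] at hζ
    exact hζ.trans (by simp)

/-- Under a test functor `H`, the images of `a` and `a'` are locally joined by a zigzag of
transition maps. Such a zigzag is witnessed by a span in `E` on which `τ` agrees, and pulling it
back to `w.obj c` shows that the agreement sieve is flatly covering. -/
lemma flatTopologyDirectImage_map_eq {t : Cocone F} (ht : IsColimit t)
    (τ : Cocone (F ⋙ flatTopologyDirectImage w e)) {c : C} {k k' : I}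
    (a : w.obj c ⟶ F.obj k) (a' : w.obj c ⟶ F.obj k')
    (h : a ≫ t.ι.app k = a' ≫ t.ι.app k') :
    (τ.ι.app k).hom.app (op c) (flatTopologySection e a) =
      (τ.ι.app k').hom.app (op c) (flatTopologySection e a') := by
  have hnat (k : I) {c c' : C} (f : c' ⟶ c) (a : w.obj c ⟶ F.obj k) :
      (τ.ι.app k).hom.app (op c') (flatTopologySection e (w.map f ≫ a)) =
        τ.pt.obj.map f.op ((τ.ι.app k).hom.app (op c) (flatTopologySection e a)) :=
    NatTrans.naturality_apply (τ.ι.app k).hom f.op (flatTopologySection e a)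
  let S : Sieve c :=
    { arrows := fun c' f =>
        τ.pt.obj.map f.op ((τ.ι.app k).hom.app (op c) (flatTopologySection e a)) =
        τ.pt.obj.map f.op ((τ.ι.app k').hom.app (op c) (flatTopologySection e a'))
      downward_closed := by
        intro c' c'' f hf g
        simpa using congrArg (τ.pt.obj.map g.op) hf }
  have hS : S ∈ flatTopology w c := by
    intro D _ K H _ _ d z
    obtain ⟨R, hR, hR'⟩ := exists_eqvGen_of_isColimit (isColimitOfPreserves H ht)
      (k := k) (k' := k') ((H.map a).hom.app _ z) ((H.map a').hom.app _ z) (by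
        have h' : H.map a ≫ H.map (t.ι.app k) = H.map a' ≫ H.map (t.ι.app k') := by
          rw [← H.map_comp, h, H.map_comp]
        exact congr($(h').hom.app (op d) z))
    refine K.transitive hR _ fun d' s hs => ?_
    obtain ⟨X, r, r', x, hτ, hx, hx'⟩ := exists_of_eqvGen τ H (hR' s hs)
    -- The pullback along `(a, a')` is the part of `w.obj c` where the pair factors through the span
    -- `(r, r')`.
    obtain ⟨y, hy, hy'⟩ := exists_pullback_section
      ((IsPullback.of_hasPullback (prod.lift a a') (prod.lift r r')).map H)
      ((H.obj (w.obj c)).obj.map s.op z) x (by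
        refine pullback_section_ext ((IsPullback.of_hasBinaryProduct' (F.obj k) (F.obj k')).map H)
          ?_ ?_
        · have h1 : H.map (prod.lift a a') ≫ H.map prod.fst = H.map a := by
            rw [← H.map_comp, prod.lift_fst]
          have h2 : H.map (prod.lift r r') ≫ H.map prod.fst = H.map r := by
            rw [← H.map_comp, prod.lift_fst]
          refine congr($(h1).hom.app (op d') _).trans (Eq.trans ?_
            congr($(h2).hom.app (op d') x).symm)
          exact (NatTrans.naturality_apply _ _ _).trans hx.symm
        · have h1 : H.map (prod.lift a a') ≫ H.map prod.snd = H.map a' := by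
            rw [← H.map_comp, prod.lift_snd]
          have h2 : H.map (prod.lift r r') ≫ H.map prod.snd = H.map r' := by
            rw [← H.map_comp, prod.lift_snd]
          refine congr($(h1).hom.app (op d') _).trans (Eq.trans ?_
            congr($(h2).hom.app (op d') x).symm)
          exact (NatTrans.naturality_apply _ _ _).trans hx'.symm)
    obtain ⟨c', f, p, hf, hcov⟩ := exists_liftSieve_map_mem hw
      (pullback.fst (prod.lift a a') (prod.lift r r'))
    refine K.superset_covering (fun d'' s' hs' => ?_) (hcov D K H d' y)
    obtain ⟨⟨⟩, ζ, hζ⟩ := hs'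
    refine ⟨⟨c', f, ?_⟩, ζ, ?_⟩
    · change _ = _
      have h1 : w.map f ≫ a = (p ≫ pullback.snd (prod.lift a a') (prod.lift r r')) ≫ r := by
        have := pullback.condition (f := prod.lift a a') (g := prod.lift r r') =≫ prod.fst
        simp only [Category.assoc, prod.lift_fst] at this
        rw [hf, Category.assoc, Category.assoc, this]
      have h2 : w.map f ≫ a' = (p ≫ pullback.snd (prod.lift a a') (prod.lift r r')) ≫ r' := by
        have := pullback.condition (f := prod.lift a a') (g := prod.lift r r') =≫ prod.snd
        simp only [Category.assoc, prod.lift_snd] at this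
        rw [hf, Category.assoc, Category.assoc, this]
      rw [← hnat, ← hnat, h1, h2]
      exact congr(($hτ).hom.app (op c') (flatTopologySection e _))
    · rw [hy] at hζ
      exact hζ.trans (by simp)
  exact sheaf_separated τ.pt hS fun c' f hf => hf

lemma preservesFiniteColimits_flatTopologyDirectImage :
    PreservesFiniteColimits (flatTopologyDirectImage w e) := by
  refine ⟨fun I _ _ => ⟨fun {F} => ⟨fun {t} ht => ?_⟩⟩⟩
  have := jointlyLocallySurjective_flatTopologyDirectImage_map e hw ht
  refine ⟨IsColimit.ofExistsUnique fun τ => this.existsUnique_desc τ.ι.app ?_⟩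
  rintro k k' c ⟨a⟩ ⟨a'⟩ h
  exact flatTopologyDirectImage_map_eq e hw ht τ a a' congr(($h).down)

end

variable (w) in
/-- A fully faithful functor followed by the restricted Yoneda embedding is the Yoneda
embedding. -/
noncomputable def compRestrictedULiftYonedaIso [w.Full] [w.Faithful] :
    uliftYoneda.{u} ≅ w ⋙ Presheaf.restrictedULiftYoneda.{u} w :=
  NatIso.ofComponents (fun c => NatIso.ofComponents
    (fun c' => (Equiv.ulift.trans ((Functor.FullyFaithful.ofFullyFaithful w).homEquiv.trans
      Equiv.ulift.symm)).toIso)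
    (fun f => by ext ⟨g⟩; exact congrArg ULift.up (w.map_comp f.unop g)))
    (fun f => by ext c' ⟨g⟩; exact congrArg ULift.up (w.map_comp g f))

/-- The direct image of `w.obj c` is represented by `c`. -/
noncomputable def compFlatTopologyDirectImageIso [HasFiniteLimits C] [PreservesFiniteLimits w]
    [w.Full] [w.Faithful] {D₀ : Type u} [SmallCategory D₀] {K₀ : GrothendieckTopology D₀}
    (e : E ≌ Sheaf K₀ (Type u)) :
    w ⋙ flatTopologyDirectImage w e ≅ toSheaves (flatTopology w) :=
  (Functor.isoWhiskerLeft (w ⋙ flatTopologyDirectImage w e)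
    (asIso (sheafificationAdjunction (flatTopology w) (Type u)).counit)).symm ≪≫
    Functor.isoWhiskerRight (compRestrictedULiftYonedaIso w).symm
      (presheafToSheaf (flatTopology w) (Type u))

namespace Topoi

/-- Every topos has a flat embedding in a flatly presented topos with a dense subcategory
contained in its essential image. -/
theorem exists_embFlat_isFlatlyPresented (E : Topoi.{u}) :
    ∃ (E' : Topoi.{u}) (j : E ⟶ E'), EmbFlat j ∧ IsFlatlyPresented E' ∧
      ∃ (C : Type u) (_ : SmallCategory C) (v : C ⥤ E') (_ : v.IsDense),
        ∀ c, j.direct.essImage (v.obj c) := by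
  obtain ⟨D₀, _, K₀, ⟨e⟩⟩ := E.isTopos
  have := E.hasColimits
  have := E.hasLimits
  have : (toSheaves K₀ ⋙ e.inverse).IsDense :=
    isDense_comp_of_reflective _ e.symm.toAdjunction
  obtain ⟨C, _, _, w, _, _, _, _, hw⟩ :=
    exists_fullyFaithful_isDense_epi (toSheaves K₀ ⋙ e.inverse)
  let E' : Topoi.{u} := ⟨Sheaf (flatTopology w) (Type u), C, inferInstance, _, ⟨.refl⟩⟩
  let j : E ⟶ E' := flatGeomMorphism e (CategoryTheory.Equivalence.refl) w fun _ S hS =>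
    isLocallySurjectiveOn_of_mem_flatTopology e S hS
  have hj : PreservesFiniteColimits j.direct :=
    preservesFiniteColimits_flatTopologyDirectImage e hw
  refine ⟨E', j, ⟨⟨?_, ?_⟩, hj⟩, ⟨C, inferInstance, flatTopology w, inferInstance,
    CategoryTheory.Equivalence.refl, fun D _ K H _ _ c S hS => ?_⟩,
    C, inferInstance, toSheaves (flatTopology w), inferInstance,
    fun c => ⟨w.obj c, ⟨(compFlatTopologyDirectImageIso e).app c⟩⟩⟩
  · exact inferInstanceAs (ObjectProperty.lift _ (Presheaf.restrictedULiftYoneda.{u} w) _).Full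
  · exact inferInstanceAs
      (ObjectProperty.lift _ (Presheaf.restrictedULiftYoneda.{u} w) _).Faithful
  · have := j.adj.rightAdjoint_preservesLimits
    have : PreservesFiniteLimits (j.direct ⋙ H) := comp_preservesFiniteLimits _ _
    have : PreservesFiniteColimits (j.direct ⋙ H) := comp_preservesFiniteColimits _ _
    -- Since `j` is flat, `j.direct ⋙ H` is itself one of the test functors defining the flat
    -- topology.
    exact isLocallySurjectiveOn_of_iso
      (Functor.isoWhiskerRight (compFlatTopologyDirectImageIso e) H) (hS D K (j.direct ⋙ H))

end Topoi

end FlatTopology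

/-! ### Retraction onto a flat-complete topos, and the main theorem. -/

section

variable {B : Type u} [Bicategory.{w, v} B]

/-- If `e` is a retract of `e'`, then a right Kan extension to `e'` preserved by the retraction
`r` and by `r ≫ g` induces a right Kan extension to `e` preserved by `g`. -/
lemma isRightKanExtension_rightExtensionComp_of_retract {e e' d a b : B} {j : e ⟶ e'}
    {r : e' ⟶ e} (η : j ≫ r ≅ 𝟙 e) (g : e ⟶ d) {i : a ⟶ b} {x : a ⟶ e}
    {t' : RightExtension i (x ≫ j)} (h₁ : IsRightKanExtension (rightExtensionComp t' r))
    (h₂ : IsRightKanExtension (rightExtensionComp t' (r ≫ g))) {t : RightExtension i x}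
    (ht : IsRightKanExtension t) : IsRightKanExtension (rightExtensionComp t g) := by
  let φ : (x ≫ j) ≫ r ≅ x := α_ x j r ≪≫ whiskerLeftIso x η ≪≫ ρ_ x
  let s : RightExtension i x :=
    RightExtension.mk (t'.extension ≫ r) ((rightExtensionComp t' r).counit ≫ φ.hom)
  have hs : IsRightKanExtension s := by
    refine h₁.of_iso (Iso.refl _) φ ?_
    change i ◁ 𝟙 (t'.extension ≫ r) ≫ (rightExtensionComp t' r).counit ≫ φ.hom = _
    rw [Bicategory.whiskerLeft_id, Category.id_comp]
    rfl
  refine IsRightKanExtension.rightExtensionComp_of_isRightKanExtension ?_ hs ht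
  refine h₂.of_iso (α_ t'.extension r g).symm ((α_ (x ≫ j) r g).symm ≪≫ whiskerRightIso φ g) ?_
  have key (k : b ⟶ e') (β : i ≫ k ⟶ x ≫ j) (ψ : (x ≫ j) ≫ r ⟶ x) :
      i ◁ (α_ k r g).inv ≫ (α_ i (k ≫ r) g).inv ≫ (((α_ i k r).inv ≫ β ▷ r) ≫ ψ) ▷ g =
        ((α_ i k (r ≫ g)).inv ≫ β ▷ (r ≫ g)) ≫ (α_ (x ≫ j) r g).inv ≫ ψ ▷ g := by
    simp
  exact key _ _ _

end

/-- A transformation `σ : L ⋙ R ⟶ 𝟭 E'` is the counit of an adjunction if `L` maps it to the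
inverse of an isomorphism `𝟭 E ≅ R ⋙ L` and `L` detects the identity of `R`. -/
lemma nonempty_adjunction_of_map_counit {E E' : Type*} [Category* E] [Category* E']
    {R : E ⥤ E'} {L : E' ⥤ E} (η : 𝟭 E ≅ R ⋙ L) (σ : L ⋙ R ⟶ 𝟭 E')
    (hσ : ∀ Y, L.map (σ.app Y) = η.inv.app (L.obj Y))
    (h : ∀ φ : R ⟶ R, (∀ X, L.map (φ.app X) = 𝟙 _) → φ = 𝟙 R) : Nonempty (R ⊣ L) := by
  -- The composite of the left triangle is an endomorphism of `R` that `L` sends to the identity;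
  -- the right triangle follows directly from `hσ`.
  have hR := h (R.rightUnitor.inv ≫ Functor.whiskerRight η.hom R ≫
    (Functor.associator _ _ _).hom ≫ Functor.whiskerLeft R σ ≫ R.leftUnitor.hom) fun X => by
      have h1 := η.inv.naturality (η.hom.app X)
      have h2 := η.inv_hom_id_app X
      dsimp at h1 h2 ⊢
      simp only [Category.id_comp, Category.comp_id, L.map_comp, hσ]
      rw [h1, η.inv_hom_id_app]
      rfl
  exact ⟨Adjunction.mkOfUnitCounit
    { unit := η.hom
      counit := σ
      left_triangle := by
        ext X
        simpa using congr_app hR X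
      right_triangle := by
        ext Y
        simp [hσ] }⟩

namespace Topoi

/-- A right Kan extension `r` of the identity along `j` has a colimit-preserving direct image
functor if the identity is a right Kan extension of `j` along `j`. -/
lemma isSpartan_of_isRightKanExtension {E E' : Topoi.{u}} {j : E ⟶ E'}
    (hj : IsRightKanExtension (RightExtension.mk (𝟙 E') (ρ_ j).hom : RightExtension j j))
    {t : RightExtension j (𝟙 E)} (ht : IsRightKanExtension t) [IsIso t.counit] :
    IsSpartan t.extension := by
  let r : E' ⟶ E := t.extension
  let η : j ≫ r ≅ 𝟙 E := asIso t.counit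
  -- The existence half of `hj` supplies the counit of `r^* ⊣ j^*`; the uniqueness half of `ht` then
  -- supplies the triangle identity.
  obtain ⟨σ, hσ, -⟩ := (isRightKanExtension_iff _).1 hj (r ≫ j)
    ((α_ j r j).inv ≫ η.hom ▷ j ≫ (λ_ j).hom)
  obtain ⟨adj⟩ := nonempty_adjunction_of_map_counit (R := r.inverse) (L := j.inverse)
    ⟨η.inv.app, η.hom.app, congr(($η.inv_hom_id).app), congr(($η.hom_inv_id).app)⟩ σ.app
    (fun Y => by
      have h : j.inverse.map (σ.app.app Y) ≫ 𝟙 _ =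
          𝟙 _ ≫ η.hom.app.app (j.inverse.obj Y) ≫ 𝟙 _ := congr(($hσ).app.app Y)
      exact (Category.comp_id _).symm.trans
        (h.trans ((Category.id_comp _).trans (Category.comp_id _))))
    (fun φ hφ => by
      obtain ⟨τ, -, hτ⟩ := (isRightKanExtension_iff t).1 ht r η.hom
      have h : (⟨φ⟩ : r ⟶ r) = 𝟙 r := by
        refine (hτ _ ?_).trans (hτ (𝟙 r) ?_).symm
        · refine GeomMorphism.hom_ext (NatTrans.ext (funext fun X => ?_))
          exact (congrArg (· ≫ η.hom.app.app X) (hφ X)).trans (Category.id_comp _)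
        · exact (congrArg (· ≫ η.hom) (Bicategory.whiskerLeft_id j r)).trans
            (Category.id_comp _)
      exact congr(($h).app))
  have := j.adj.leftAdjoint_preservesColimits
  intro J _ _ _
  exact preservesColimitsOfShape_of_natIso (adj.rightAdjointUniq r.adj)

lemma isRightKanExtension_id {E E' : Topoi.{u}} {j : E ⟶ E'} (hj : EmbFlat j) {C : Type u}
    [SmallCategory C] (v : C ⥤ E') [v.IsDense] (hv : ∀ c, j.direct.essImage (v.obj c)) :
    IsRightKanExtension (RightExtension.mk (𝟙 E') (ρ_ j).hom : RightExtension j j) := by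
  refine isRightKanExtension_of_isIso_mate hj.2 _ v fun c => ?_
  have := hj.1.1
  have := hj.1.2
  have h : (rightExtensionMate (RightExtension.mk (𝟙 E') (ρ_ j).hom : RightExtension j j)).app
      (v.obj c) = j.adj.unit.app (v.obj c) := by
    rw [rightExtensionMate_app]
    exact j.adj.homEquiv_id _
  rw [h]
  -- The mate is the unit of `j^* ⊣ j_*`, invertible on the essential image of `j_*`.
  exact j.adj.isIso_unit_app_of_iso (hv c).getIso.symm

/-- Spartan geometric morphisms between flat-complete topoi preserve right Kan extensions along
flat embeddings. -/
theorem IsSpartan.preservesRightKanExtensions {E D : Topoi.{u}} {f : E ⟶ D} (hf : IsSpartan f)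
    (hE : IsFlatComplete E) {F G : Topoi.{u}} {i : F ⟶ G} (hi : EmbFlat i) :
    PreservesRightKanExtensions f i := by
  obtain ⟨E', j, hj, hE', C, _, v, _, hv⟩ := exists_embFlat_isFlatlyPresented E
  -- The extension of the identity along `j` is the retraction of `E'` onto `E`.
  obtain ⟨t₀, ht₀, _⟩ := (isRightKanInjective_iff j).1 (hE j hj) (𝟙 E)
  have hr := isSpartan_of_isRightKanExtension (isRightKanExtension_id hj v hv) ht₀
  intro x t ht
  obtain ⟨t', C', _, v', _, hv'⟩ := hE'.exists_rightExtension hi.2 (x ≫ j)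
  have hrf : IsSpartan (t₀.extension ≫ f) := fun J _ _ _ => by
    have := hr J
    have := hf J
    exact comp_preservesColimitsOfShape _ _
  exact isRightKanExtension_rightExtensionComp_of_retract (asIso t₀.counit) f
    (isRightKanExtension_rightExtensionComp hi.2 t' v' hv' hr)
    (isRightKanExtension_rightExtensionComp hi.2 t' v' hv' hrf) ht

end Topoi

theorem mainTheorem3 :
    (∀ (E D : Topoi.{u}) (f : E ⟶ D), Topoi.IsFlatComplete E → Topoi.IsFlatComplete D →
      Topoi.IsSpartan f → IsRightKanInjectiveHom Topoi.EmbFlat f) ∧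
    Topoi.CohTopoiS.{u}.IsIncludedIn (RInj Topoi.EmbFlat) := by
  have h₁ (E D : Topoi.{u}) (f : E ⟶ D) (hE : Topoi.IsFlatComplete E)
      (hD : Topoi.IsFlatComplete D) (hf : Topoi.IsSpartan f) :
      IsRightKanInjectiveHom Topoi.EmbFlat f :=
    ⟨hE, hD, fun _ _ _ hi => hf.preservesRightKanExtensions hE hi⟩
  exact ⟨h₁, fun E hE => hE.isFlatlyPresented.isFlatComplete, fun {E D} f hf =>
    h₁ E D f hf.1.isFlatlyPresented.isFlatComplete hf.2.1.isFlatlyPresented.isFlatComplete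
      hf.2.2⟩
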